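/- **Setting.** Let $\gamma:\mathbb R\to\mathbb S^2\subset\mathbb R^3$ (coordinates $x,y,z$) be a curve of class $C^4$ parameterized by arc length, with geodesic curvature $\kappa=\langle\ddot\gamma,\gamma\times\dot\gamma\rangle$. Let $\lambda\in\mathbb R$. We call $\gamma$ a *B-curve* with multiplier $\lambda$ if $\kappa>0$, $\kappa$ is non-constant and periodic, and $\mu:=\sqrt\kappa$ satisfies, for some constant $\xi>0$, $$\dot\mu^2=-\mu^2Q(\mu),\qquad Q(t)=t^4+4\lambda t^3+4(\lambda^2-\xi^2)t^2+1 .$$ Let $\eta_\lambda$ be the unique positive root of $t^4+2\lambda t^3-1$. For $e_1>\eta_\lambda$ put $\xi=\frac1{2e_1}\sqrt{1+(e_1(e_1+2\lambda))^2}$; then $Q$ has exactly two positive roots, $e_1$ and $e_2<e_1$. The *standard B-curve* with parameters $(\lambda,e_1)$ is the B-curve with this $\xi$ such that, $\omega$ denoting the least period of $\mu$ and $D=\sqrt{1+(e_1(e_1+2\lambda))^2}$, $$\mu(\tfrac\omega2)=e_1,\qquad \gamma(\tfrac\omega2)=\tfrac1D\bigl(1,-e_1(e_1+2\lambda),0\bigr),\qquad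 \dot\gamma(\tfrac\omega2)=(0,0,-1).$$ It is a *B-string* if $\gamma$ is periodic. For $\lambda<0$ let $u_\lambda$ be the unique positive root of $4\lambda^2t^3+8\lambda^3t^2-t+2\lambda$, and let $u_\lambda=\infty$ for $\lambda\ge0$. Put $$\theta(s)=2\xi\int_{\omega/2}^{s}\frac{\mu^2(\mu+2\lambda)}{1-4\xi^2\mu^2}\,dt,\qquad \Psi=\theta(\omega)-\theta(0).$$ The B-string has *characteristic number* $m/n$, where $m,n$ are coprime integers with $0<m<n$, if $\Psi\equiv 2\pi m/n\pmod{2\pi}$ when $e_1\ne u_\lambda$, and $\Psi+\pi=2\pi m/n$ when $e_1=u_\lambda$. **Theorem.** Let $\gamma$ be a standard B-string with parameters $(\lambda,e_1)$, $e_1>\eta_\lambda$, and characteristic number $m/n$. 1. The trajectory $\gamma(\mathbb R)$ is invariant under the group generated by the rotation by $2\pi/n$ about the $Ox$-axis, and $\gamma$ lies between the planes: $\frac1{2\xi e_1}\le x\le\frac1{2\xi e_2}$. 2. If $e_1\neq u_\lambda$, then $\gamma$ does not meet the $Ox$-axis. Moreover: (a) if $e_1<u_\lambda$, then the linking number of $\gamma$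 (run once) with the $Ox$-axis, oriented upward (in the direction of increasing $x$), is $n-m$, and $\gamma$ has exactly $n(n-m-1)$ ordinary double points (points passed exactly twice in a period, with distinct tangent lines) and no other points of self-intersection; (b) if $e_1>u_\lambda$, then the linking number of $\gamma$ with the upward oriented $Ox$-axis is $-m$, and $\gamma$ has at least $nm$ points of self-intersection. 3. If $e_1=u_\lambda$, then $\gamma$ meets the $Ox$-axis exactly $n$ times in a period; the moving point $\gamma(s)$ travels counter-clockwise around the upward oriented $Ox$-axis, that is, $y\dot z-z\dot y>0$ whenever $\gamma(s)$ is off the axis; and the projection $(y,z)$ of $\gamma$ to the plane $x=0$ is a closed regular curve of turning number $n-m$. Here the linking number of a closed curve disjoint from the $Ox$-axis is the winding number around the origin of its projection $(y,z)$, and the turning number of a closed regular plane curve is the winding number of its velocity around the origin. -/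

import Mathlib

open scoped Real

noncomputable section

namespace BCurves

/-- Euclidean three-space; the coordinates `x, y, z` of `v` are `v 0, v 1, v 2`. -/
abbrev E3 : Type := EuclideanSpace ℝ (Fin 3)

/-- The vector cross product of Euclidean three-space. -/
def cross (u v : E3) : E3 := WithLp.toLp 2 (crossProduct u.ofLp v.ofLp)

/-- The signed geodesic curvature of a unit-speed curve on the unit sphere: the component of the
covariant acceleration along the unit normal `N = γ × γ'`, the counter-clockwise rotation of the
tangent `γ'` by `π / 2` (the sphere being oriented by its outward normal). Since `N` is tangent to
the sphere, the tangential projection of `γ''` may be replaced by `γ''`. -/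
def curvature (γ : ℝ → E3) (s : ℝ) : ℝ :=
  inner ℝ (deriv (deriv γ) s) (cross (γ s) (deriv γ s))

/-- The `μ`-invariant of a convex curve. -/
def muInv (γ : ℝ → E3) (s : ℝ) : ℝ := √(curvature γ s)

/-- The least positive period of a periodic function. -/
def leastPeriod {α : Type*} (f : ℝ → α) : ℝ :=
  sInf {T : ℝ | 0 < T ∧ Function.Periodic f T}

/-- The quartic polynomial `Q(t) = t⁴ + 4λt³ + 4(λ² - ξ²)t² + 1`. -/
def quartic (lam ξ t : ℝ) : ℝ :=
  t ^ 4 + 4 * lam * t ^ 3 + 4 * (lam ^ 2 - ξ ^ 2) * t ^ 2 + 1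

/-- The value `η_λ`: the unique positive solution of `t⁴ + 2λt³ - 1 = 0`. -/
def eta (lam : ℝ) : ℝ := sInf {t : ℝ | 0 < t ∧ t ^ 4 + 2 * lam * t ^ 3 - 1 = 0}

/-- The constant of integration `ξ` in terms of `λ` and `e₁`; it is the positive number for which
`e₁` is a root of `quartic lam ξ`. -/
def xi (lam e₁ : ℝ) : ℝ := 1 / (2 * e₁) * √(1 + (e₁ * (e₁ + 2 * lam)) ^ 2)

/-- The smaller positive root `e₂` of the quartic with parameters `(λ, e₁)`. (For `e₁ > η_λ` the
quartic has exactly two positive roots, and `e₁` is the larger one.) -/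
def eTwo (lam e₁ : ℝ) : ℝ := sInf {t : ℝ | 0 < t ∧ quartic lam (xi lam e₁) t = 0}

/-- The value `u_λ`: for `λ < 0` the unique positive root of
`4λ²t³ + 8λ³t² - t + 2λ = 0`, and `∞` for `λ ≥ 0`. -/
def exceptional (lam : ℝ) : EReal :=
  if lam < 0 then
    ((sInf {t : ℝ | 0 < t ∧
      4 * lam ^ 2 * t ^ 3 + 8 * lam ^ 3 * t ^ 2 - t + 2 * lam = 0} : ℝ) : EReal)
  else ⊤

/-- `γ` is a B-curve with multiplier `λ` and constant of integration `ξ`: a convex curve of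
class `C⁴` on the unit sphere, parameterized by arc length, with non-constant periodic curvature,
whose `μ`-invariant satisfies `(μ')² = -μ² Q(μ)`. -/
structure IsBCurve (lam ξ : ℝ) (γ : ℝ → E3) : Prop where
  contDiff : ContDiff ℝ 4 γ
  mem_sphere : ∀ s, γ s ∈ Metric.sphere (0 : E3) 1
  unit_speed : ∀ s, ‖deriv γ s‖ = 1
  convex : ∀ s, 0 < curvature γ s
  nonconstant : ¬ ∃ c : ℝ, ∀ s, curvature γ s = c
  periodic_curvature : ∃ T : ℝ, 0 < T ∧ Function.Periodic (curvature γ) T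
  xi_pos : 0 < ξ
  conservation : ∀ s,
    deriv (muInv γ) s ^ 2 = -(muInv γ s ^ 2 * quartic lam ξ (muInv γ s))

/-- `γ` is the standard B-curve with parameters `(λ, e₁)`: its constant of integration is
`xi lam e₁` and, `ω` being the least period of `μ`, it has the prescribed values of `μ`, `γ`
and `γ'` at `ω / 2`. -/
structure IsStandardBCurve (lam e₁ : ℝ) (γ : ℝ → E3) : Prop where
  isBCurve : IsBCurve lam (xi lam e₁) γ
  mu_init : muInv γ (leastPeriod (muInv γ) / 2) = e₁
  pos_init : γ (leastPeriod (muInv γ) / 2) =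
    !₂[1 / √(1 + (e₁ * (e₁ + 2 * lam)) ^ 2),
       -(e₁ * (e₁ + 2 * lam)) / √(1 + (e₁ * (e₁ + 2 * lam)) ^ 2), 0]
  vel_init : deriv γ (leastPeriod (muInv γ) / 2) = !₂[0, 0, -1]

/-- The standard B-string with parameters `(λ, e₁)`, `e₁ > η_λ`: a standard B-curve that is
periodic. -/
structure IsStandardBString (lam e₁ : ℝ) (γ : ℝ → E3) : Prop where
  parameters : eta lam < e₁
  isStandard : IsStandardBCurve lam e₁ γ
  periodic : ∃ T : ℝ, 0 < T ∧ Function.Periodic γ T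

/-- The angular function
`θ(s) = 2ξ ∫_{ω/2}^s μ²(μ + 2λ) / (1 - 4ξ²μ²)`. The integrand extends continuously to the
isolated points (if any) at which its denominator vanishes. -/
def angular (lam ξ : ℝ) (μ : ℝ → ℝ) (s : ℝ) : ℝ :=
  2 * ξ * ∫ t in (leastPeriod μ / 2)..s,
    μ t ^ 2 * (μ t + 2 * lam) / (1 - 4 * ξ ^ 2 * μ t ^ 2)

/-- The jump `Ψ = θ(ω) - θ(0)`. -/
def jump (lam ξ : ℝ) (μ : ℝ → ℝ) : ℝ :=
  angular lam ξ μ (leastPeriod μ) - angular lam ξ μ 0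

/-- The standard B-curve `γ` with parameters `(λ, e₁)` has characteristic number `m / n`, in
lowest terms with `0 < m < n`: the regularized jump equals `2π m / n`, where the regularized jump
is `Ψ + π` if `e₁ = u_λ`, and is `Ψ` taken modulo `2π` otherwise. -/
structure HasCharacteristicNumber (lam e₁ : ℝ) (γ : ℝ → E3) (m n : ℕ) : Prop where
  pos : 0 < m
  lt : m < n
  coprime : Nat.Coprime m n
  jump_of_ne : (e₁ : EReal) ≠ exceptional lam →
    ∃ k : ℤ, jump lam (xi lam e₁) (muInv γ) = 2 * π * (m / n) + 2 * π * k
  jump_of_eq : (e₁ : EReal) = exceptional lam →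
    jump lam (xi lam e₁) (muInv γ) + π = 2 * π * (m / n)

/-- The rotation by the angle `α` about the `Ox`-axis. -/
def rotOx (α : ℝ) (v : E3) : E3 :=
  !₂[v 0, Real.cos α * v 1 - Real.sin α * v 2, Real.sin α * v 1 + Real.cos α * v 2]

/-- The `Ox`-axis. -/
def axisOx : Set E3 := {v | v 1 = 0 ∧ v 2 = 0}

/-- The projection of a space curve to the plane `x = 0`, with the orthogonal coordinates `(y, z)`
of this plane (oriented by the upward direction of `Ox`) written as `y + i z`. -/
def proj (γ : ℝ → E3) (s : ℝ) : ℂ := ⟨γ s 1, γ s 2⟩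

/-- The `T`-periodic plane curve `c` avoids the origin and turns `k` times counter-clockwise around
it over a period: a continuous determination of its argument increases by `2πk`. -/
def HasWindingNumber (c : ℝ → ℂ) (T : ℝ) (k : ℤ) : Prop :=
  Function.Periodic c T ∧ (∀ s, c s ≠ 0) ∧
    ∃ φ : ℝ → ℝ, Continuous φ ∧
      (∀ s, c s = ‖c s‖ * Complex.exp (φ s * Complex.I)) ∧ φ T - φ 0 = 2 * π * k

/-- The closed curve `γ`, run once, has linking number `k` with the upward oriented `Ox`-axis. -/
def HasLinkingNumberOx (γ : ℝ → E3) (k : ℤ) : Prop :=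
  HasWindingNumber (proj γ) (leastPeriod γ) k

/-- The closed regular plane curve `c`, run once, has turning number `k`: this is the winding number
of its velocity around the origin. -/
def HasTurningNumber (c : ℝ → ℂ) (k : ℤ) : Prop :=
  Function.Periodic c (leastPeriod c) ∧ Differentiable ℝ c ∧
    HasWindingNumber (deriv c) (leastPeriod c) k

/-- The parameters in one period at which the closed curve `γ` passes through `p`. -/
def passages (γ : ℝ → E3) (p : E3) : Set ℝ :=
  {s | s ∈ Set.Ico 0 (leastPeriod γ) ∧ γ s = p}

/-- The points of self-intersection of the closed curve `γ`. -/
def selfIntersections (γ : ℝ → E3) : Set E3 := {p | 2 ≤ (passages γ p).encard}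

/-- The ordinary double points of the closed curve `γ`: points through which it passes exactly
twice in a period, with distinct tangent lines. -/
def ordinaryDoublePoints (γ : ℝ → E3) : Set E3 :=
  {p | ∃ s t : ℝ, s ≠ t ∧ passages γ p = {s, t} ∧
    LinearIndependent ℝ ![deriv γ s, deriv γ t]}

end BCurves

end

/-! Let `h`, `v`, `m` be the components of the unit vector of the `Ox`-axis along `γ`, `γ'`, `γ ×
γ'`. The conservation law makes them explicit: `h = 1/(2ξμ)`, `v = -μ'/(2ξμ²)`, `m = (μ + 2λ)/(2ξ)`.
Height and angular momentum about the axis are therefore known, and only the rotation about the axis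
remains to be integrated. Stereographic projection from the lower pole does this without
singularities: its velocity turns at the rate `B' = μ² + m/(1 + h)`, and `y + iz = (-m + iv) e^{iB}`
with `B(ω/2) = 0` (`IsStandardBString.coordinates`). By the symmetries of `μ`, the shift `s ↦ s + ω`
rotates the curve by `2B(ω)`, and `s ↦ ω - s` conjugates `y + iz`.

The crux is `0 < B(ω) < π` (`Profile.turn_omega_mem`). The lower bound holds because the gnomonic
projection of a convex spherical arc is convex; the upper bound because the stereographic image has
increasing curvature on half a period (`turning_bounds`). Off the axis the argument of `y + iz` is
`π - θ`. Comparing it with `B` gives `Ψ = -2B(ω)`, `2π - 2B(ω)` or `π - 2B(ω)` according as `e₂ +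
2λ` is positive, negative or zero (`Profile.angular_omega_add`), which is the position of `e₁`
relative to `u_λ` (`exceptional_cases`). The bounds on `B(ω)` then turn the congruence that defines
`m/n` into the single equality `2B(ω) = 2π(n - m)/n` (`turn_eq`).

So the curve closes after `n` periods, its linking number is `-nΨ/2π`, and its turning number is
`nB(ω)/π`. Height determines `μ`, whose level sets are the orbits of `s ↦ -s` and `s ↦ s + ω`. Hence
a self-intersection off the axis pairs `s` with some `-s + jω`, and this occurs only where `θ` is a
multiple of `π/n` (`fold_iff`). Counting such values on `(0, ω/2)` gives `n - m - 1` of them when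
`θ` is monotone and at least `m` when `e₁ > u_λ`; each is repeated by `n` rotations. -/

namespace BCurves

/-! ### Turning of the stereographic image of a convex spherical arc -/

/-- The angle `β` through which the stereographic projection of a convex spherical arc turns stays
above `-π / 2`: up to an angle less than `π / 2` it is the angle of the gnomonic projection. -/
theorem strictMono_gnomonic_angle {h v m κ β : ℝ → ℝ}
    (dh : ∀ s, HasDerivAt h (v s) s) (dv : ∀ s, HasDerivAt v (-h s + κ s * m s) s)
    (dm : ∀ s, HasDerivAt m (-(κ s * v s)) s)
    (dβ : ∀ s, HasDerivAt β (κ s + m s / (1 + h s)) s)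
    (hh : ∀ s, 0 < h s) (hκ : ∀ s, 0 < κ s) (unit : ∀ s, h s ^ 2 + v s ^ 2 + m s ^ 2 = 1) :
    StrictMono fun s => β s + Real.arctan (v s * m s / (h s * (1 + h s) + v s ^ 2)) := by
  refine strictMono_of_deriv_pos fun s => ?_
  have hs := hh s
  have hD : 0 < h s * (1 + h s) + v s ^ 2 := by positivity
  have hR : 0 < h s ^ 2 + v s ^ 2 := by positivity
  have h1 : 0 < 1 + h s := by positivity
  have key := (dβ s).add (((((dv s).mul (dm s)).div
    (((dh s).mul ((dh s).const_add 1)).add ((dv s).pow 2)) hD.ne')).arctan)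
  have : HasDerivAt (fun s => β s + Real.arctan (v s * m s / (h s * (1 + h s) + v s ^ 2)))
      (κ s * h s / (h s ^ 2 + v s ^ 2)) s := by
    refine key.congr_deriv ?_
    have e1 : (h s * (1 + h s) + v s ^ 2) ^ 2 + (v s * m s) ^ 2
        = (h s ^ 2 + v s ^ 2) * (1 + h s) ^ 2 := by
      linear_combination (v s ^ 2) * unit s
    have e2 : 1 / (1 + (v s * m s / (h s * (1 + h s) + v s ^ 2)) ^ 2)
        = (h s * (1 + h s) + v s ^ 2) ^ 2 / ((h s ^ 2 + v s ^ 2) * (1 + h s) ^ 2) := by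
      rw [← e1]; field_simp
    simp only [Pi.mul_apply, Pi.add_apply, Pi.pow_apply, Pi.div_apply]
    rw [e2]
    field_simp
    push_cast
    have hm2 : m s ^ 2 = 1 - h s ^ 2 - v s ^ 2 := by linarith [unit s]
    ring_nf
    rw [show m s ^ 2 = 1 - h s ^ 2 - v s ^ 2 from hm2]
    ring
  rw [this.deriv]
  have := hκ s
  positivity

/-- The stereographic image is `σ = (-m + iv) e^{iβ} / (1 + h)`, with `σ' = -i e^{iβ} / (1 + h)` and
plane curvature `κ(1 + h) + m`. The gnomonic angle differs from `β` by an arctangent that vanishes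
with `v`, whence the lower bound. The upper bound compares `σ`, whose curvature increases, with
circles of one fixed curvature. -/
theorem turning_bounds {a b : ℝ} (hab : a < b) {h v m κ β : ℝ → ℝ}
    (dh : ∀ s, HasDerivAt h (v s) s) (dv : ∀ s, HasDerivAt v (-h s + κ s * m s) s)
    (dm : ∀ s, HasDerivAt m (-(κ s * v s)) s)
    (dβ : ∀ s, HasDerivAt β (κ s + m s / (1 + h s)) s)
    (hh : ∀ s, 0 < h s) (hκ : ∀ s, 0 < κ s) (unit : ∀ s, h s ^ 2 + v s ^ 2 + m s ^ 2 = 1)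
    (hv : ∀ s ∈ Set.Ioo a b, v s < 0) (va : v a = 0) (vb : v b = 0)
    (mono : StrictMonoOn (fun s => κ s * (1 + h s) + m s) (Set.Icc a b)) (βa : β a = 0) :
    0 < β b ∧ β b < π := by
  have hg := strictMono_gnomonic_angle dh dv dm dβ hh hκ unit
  have hπ := Real.pi_pos
  have lower : ∀ s, a ≤ s → -(π / 2) < β s := by
    intro s hs
    have h1 := hg.monotone hs
    simp only [va, βa, zero_mul, zero_div, Real.arctan_zero, add_zero] at h1
    have h2 := Real.arctan_lt_pi_div_two (v s * m s / (h s * (1 + h s) + v s ^ 2))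
    linarith
  have pos : 0 < β b := by
    have h1 := hg hab
    simpa only [va, vb, βa, zero_mul, zero_div, Real.arctan_zero, add_zero] using h1
  refine ⟨pos, ?_⟩
  by_contra! hbπ
  have cβ : Continuous β := continuous_iff_continuousAt.2 fun s => (dβ s).continuousAt
  set k : ℝ → ℝ := fun s => κ s * (1 + h s) + m s with hk
  have h1h : ∀ s, 0 < 1 + h s := fun s => by linarith [hh s]
  have dβk : ∀ s, deriv β s = k s / (1 + h s) := fun s => by
    rw [(dβ s).deriv, hk]; field_simp [(h1h s).ne']
  have up : ∀ p q, a ≤ p → p ≤ q → q ≤ b → 0 ≤ k p → β p ≤ β q := by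
    intro p q hap hpq hqb hp
    refine monotoneOn_of_deriv_nonneg (convex_Icc p q) cβ.continuousOn
      (fun s _ => (dβ s).differentiableAt.differentiableWithinAt) (fun s hs => ?_)
      (Set.left_mem_Icc.2 hpq) (Set.right_mem_Icc.2 hpq) hpq
    rw [interior_Icc] at hs
    rw [dβk]
    have := mono ⟨hap, by linarith⟩ ⟨by linarith [hs.1], by linarith [hs.2]⟩ hs.1
    exact div_nonneg (by linarith) (h1h s).le
  have down : ∀ p, a ≤ p → p ≤ b → k p ≤ 0 → β p ≤ 0 := by
    intro p hap hpb hp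
    rw [← βa]
    refine antitoneOn_of_deriv_nonpos (convex_Icc a p) cβ.continuousOn
      (fun s _ => (dβ s).differentiableAt.differentiableWithinAt) (fun s hs => ?_)
      (Set.left_mem_Icc.2 hap) (Set.right_mem_Icc.2 hap) hap
    rw [interior_Icc] at hs
    rw [dβk]
    have := mono ⟨hs.1.le, by linarith [hs.2]⟩ ⟨hap, hpb⟩ hs.2
    exact div_nonpos_of_nonpos_of_nonneg (by linarith)
      (h1h s).le
  obtain ⟨c, hc, hcπ⟩ := intermediate_value_Icc hab.le cβ.continuousOn
    (show π ∈ Set.Icc (β a) (β b) from ⟨by rw [βa]; exact hπ.le, hbπ⟩)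
  obtain ⟨d, hd, hdπ⟩ := intermediate_value_Icc hc.1 cβ.continuousOn
    (show π / 2 ∈ Set.Icc (β a) (β c) from ⟨by rw [βa]; linarith, by rw [hcπ]; linarith⟩)
  have had : a < d := lt_of_le_of_ne hd.1 fun e => by rw [← e, βa] at hdπ; linarith
  have hkd : 0 < k d := by
    by_contra! hcon
    have := down d hd.1 (hd.2.trans hc.2) hcon
    linarith
  have kmono : ∀ p q, a ≤ p → p < q → q ≤ b → k p < k q := fun p q h1 h2 h3 =>
    mono ⟨h1, by linarith⟩ ⟨by linarith, h3⟩ h2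
  -- `-f` is the imaginary coordinate of the centre `σ + e^{iβ} / k d` of the circle of curvature `k
  -- d` tangent to `σ`. Both factors `cos β` and `1 - k / k d` of its derivative change sign at `d`,
  -- so `f` increases from `a` to `c`; but `f a = 0`, while `f c` has the sign of `v c ≤ 0`.
  let f : ℝ → ℝ := fun s =>
    (-(v s) * Real.cos (β s) + m s * Real.sin (β s)) / (1 + h s) - Real.sin (β s) / k d
  have df : ∀ s, HasDerivAt f (Real.cos (β s) * (1 - k s / k d) / (1 + h s)) s := by
    intro s
    have h1 := (((((dv s).neg.mul (dβ s).cos).add ((dm s).mul (dβ s).sin)).div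
      ((dh s).const_add 1) (h1h s).ne').sub ((dβ s).sin.div_const (k d)))
    refine h1.congr_deriv ?_
    have hs := (h1h s).ne'
    have hks : k s = κ s * (1 + h s) + m s := rfl
    rw [hks]
    simp only [Pi.mul_apply, Pi.add_apply, Pi.neg_apply]
    field_simp
    have hm2 : m s ^ 2 = 1 - h s ^ 2 - v s ^ 2 := by linarith [unit s]
    ring_nf
    rw [show m s ^ 2 = 1 - h s ^ 2 - v s ^ 2 from hm2]
    ring
  have cf : Continuous f := continuous_iff_continuousAt.2 fun s => (df s).continuousAt
  have f1 : StrictMonoOn f (Set.Icc a d) := by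
    refine strictMonoOn_of_deriv_pos (convex_Icc a d) cf.continuousOn fun s hs => ?_
    rw [interior_Icc] at hs
    rw [(df s).deriv]
    have h1 := lower s hs.1.le
    have hkk := kmono s d hs.1.le hs.2 (hd.2.trans hc.2)
    have h2 : β s < π / 2 := by
      rcases le_or_gt (k s) 0 with h | h
      · have := down s hs.1.le (by linarith [hs.2, hd.2, hc.2]) h
        linarith
      · have e : StrictMonoOn β (Set.Icc s d) := by
          refine strictMonoOn_of_deriv_pos (convex_Icc s d) cβ.continuousOn fun t ht => ?_
          rw [interior_Icc] at ht
          rw [dβk]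
          have := kmono s t hs.1.le ht.1 (by linarith [ht.2, hd.2, hc.2])
          exact div_pos (h.trans this) (h1h t)
        have := e (Set.left_mem_Icc.2 hs.2.le) (Set.right_mem_Icc.2 hs.2.le) hs.2
        linarith
    refine div_pos (mul_pos (Real.cos_pos_of_mem_Ioo ⟨h1, h2⟩) ?_) (h1h s)
    rw [sub_pos, div_lt_one hkd]; exact hkk
  have f2 : MonotoneOn f (Set.Icc d c) := by
    refine monotoneOn_of_deriv_nonneg (convex_Icc d c) cf.continuousOn
      (fun s _ => (df s).differentiableAt.differentiableWithinAt) fun s hs => ?_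
    rw [interior_Icc] at hs
    rw [(df s).deriv]
    have hkk := kmono d s hd.1 hs.1 (by linarith [hs.2, hc.2])
    have h1 := up d s hd.1 hs.1.le (by linarith [hs.2, hc.2]) hkd.le
    have h2 := up s c (by linarith [hs.1, hd.1]) hs.2.le hc.2 (hkd.trans hkk).le
    refine div_nonneg (mul_nonneg_of_nonpos_of_nonpos
      (Real.cos_nonpos_of_pi_div_two_le_of_le (by linarith) (by linarith)) ?_) (h1h s).le
    rw [sub_nonpos, one_le_div hkd]; exact hkk.le
  have h1 := f1 (Set.left_mem_Icc.2 had.le) (Set.right_mem_Icc.2 had.le) had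
  have h2 := f2 (Set.left_mem_Icc.2 hd.2) (Set.right_mem_Icc.2 hd.2) hd.2
  have hfa : f a = 0 := by simp [f, va, βa]
  have hfc : f c = v c / (1 + h c) := by simp [f, hcπ]
  have hvc : v c ≤ 0 := by
    rcases eq_or_lt_of_le hc.2 with e | e
    · rw [e, vb]
    · exact (hv c ⟨by linarith [hd.2], e⟩).le
  have := div_nonpos_of_nonpos_of_nonneg hvc (h1h c).le
  linarith


/-! ### The parameters -/

theorem mul_neg_iff_of_pos {a b : ℝ} (ha : 0 < a) : a * b < 0 ↔ b < 0 :=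
  ⟨fun h => by by_contra! hb; exact h.not_ge (mul_nonneg ha.le hb), mul_neg_of_pos_of_neg ha⟩

theorem mul_eq_zero_iff_of_pos {a b : ℝ} (ha : 0 < a) : a * b = 0 ↔ b = 0 := by
  rw [mul_eq_zero, or_iff_right ha.ne']

theorem cube_mul_lt {lam s t : ℝ} (hs : 0 < s) (h : 0 < s + 2 * lam) (hst : s < t) :
    s ^ 3 * (s + 2 * lam) < t ^ 3 * (t + 2 * lam) :=
  mul_lt_mul'' (pow_lt_pow_left₀ hst hs.le (by norm_num)) (by linarith) (by positivity) h.le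

theorem exists_eta_root (lam : ℝ) : ∃ t : ℝ, 0 < t ∧ t ^ 4 + 2 * lam * t ^ 3 - 1 = 0 := by
  have hM : (0 : ℝ) ≤ 2 * |lam| + 1 := by positivity
  have hc : Continuous fun t : ℝ => t ^ 4 + 2 * lam * t ^ 3 - 1 := by fun_prop
  -- At `t = 2|λ| + 1` both factors of `t³(t + 2λ)` are at least `1`.
  have h1 : (0 : ℝ) ≤ (2 * |lam| + 1) ^ 4 + 2 * lam * (2 * |lam| + 1) ^ 3 - 1 := by
    have h2 : 1 ≤ (2 * |lam| + 1) ^ 3 := one_le_pow₀ (by linarith [abs_nonneg lam])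
    have h3 : 1 ≤ 2 * |lam| + 1 + 2 * lam := by linarith [neg_abs_le lam]
    nlinarith
  obtain ⟨t, ht, h⟩ := intermediate_value_Icc hM hc.continuousOn
    (show (0 : ℝ) ∈ Set.Icc _ _ from ⟨by norm_num, h1⟩)
  refine ⟨t, lt_of_le_of_ne ht.1 fun e => ?_, h⟩
  simp [← e] at h

/-- A positive solution of `t³(t + 2λ) = 1` has `t + 2λ > 0`, and there the left side is strictly
increasing. The infimum is thus over a singleton. -/
theorem eta_spec (lam : ℝ) : 0 < eta lam ∧ eta lam ^ 3 * (eta lam + 2 * lam) = 1 := by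
  obtain ⟨t, ht, h⟩ := exists_eta_root lam
  have key : ∀ r : ℝ, 0 < r → r ^ 4 + 2 * lam * r ^ 3 - 1 = 0 →
      r ^ 3 * (r + 2 * lam) = 1 ∧ 0 < r + 2 * lam := fun r hr hr' => by
    have e : r ^ 3 * (r + 2 * lam) = 1 := by linear_combination hr'
    exact ⟨e, pos_of_mul_pos_right (e ▸ one_pos) (by positivity)⟩
  have hset : {r : ℝ | 0 < r ∧ r ^ 4 + 2 * lam * r ^ 3 - 1 = 0} = {t} := by
    refine Set.eq_singleton_iff_unique_mem.2 ⟨⟨ht, h⟩, fun r ⟨hr, hr'⟩ => ?_⟩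
    obtain ⟨a1, a2⟩ := key r hr hr'
    obtain ⟨b1, b2⟩ := key t ht h
    rcases lt_trichotomy r t with e | e | e
    · linarith [cube_mul_lt hr a2 e]
    · exact e
    · linarith [cube_mul_lt ht b2 e]
  rw [eta, hset, csInf_singleton]
  exact ⟨ht, (key t ht h).1⟩

/-- The relations between the parameters `λ`, `ξ` and the positive roots `e₂ < e₁` of the
quartic. -/
structure Roots (lam ξ e₁ e₂ : ℝ) : Prop where
  xi_pos : 0 < ξ
  pos : 0 < e₂
  lt : e₂ < e₁
  top_pos : 0 < e₁ + 2 * lam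
  factor : ∀ t, quartic lam ξ t =
    (t - e₁) * (t - e₂) * (t ^ 2 + (e₁ + e₂) / (e₁ * e₂) ^ 2 * t + 1 / (e₁ * e₂))

theorem Roots.cofactor_pos {lam ξ e₁ e₂ : ℝ} (hr : Roots lam ξ e₁ e₂) {t : ℝ} (ht : 0 < t) :
    0 < t ^ 2 + (e₁ + e₂) / (e₁ * e₂) ^ 2 * t + 1 / (e₁ * e₂) := by
  have := hr.pos
  have : 0 < e₁ := hr.pos.trans hr.lt
  positivity

theorem Roots.mem_Icc {lam ξ e₁ e₂ : ℝ} (hr : Roots lam ξ e₁ e₂) {t : ℝ} (ht : 0 < t) :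
    quartic lam ξ t ≤ 0 ↔ t ∈ Set.Icc e₂ e₁ := by
  rw [hr.factor, mul_nonpos_iff_neg_imp_nonneg, Set.mem_Icc]
  have hc := hr.cofactor_pos ht
  have hlt := hr.lt
  constructor
  · intro h
    have h1 : (t - e₁) * (t - e₂) ≤ 0 := by
      by_contra! hcon
      linarith [h.2 hc]
    constructor <;> by_contra! <;> nlinarith
  · rintro ⟨h1, h2⟩
    have : (t - e₁) * (t - e₂) ≤ 0 := by nlinarith
    exact ⟨fun _ => hc.le, fun _ => this⟩

theorem Roots.eq_zero_iff {lam ξ e₁ e₂ : ℝ} (hr : Roots lam ξ e₁ e₂) {t : ℝ} (ht : 0 < t) :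
    quartic lam ξ t = 0 ↔ t = e₁ ∨ t = e₂ := by
  rw [hr.factor, mul_eq_zero, or_iff_left (hr.cofactor_pos ht).ne', mul_eq_zero, sub_eq_zero,
    sub_eq_zero]

/-- Two roots determine the cofactor, since the quartic has constant term `1` and no linear term.
The coefficients of the cofactor are positive, so `e₁` and `e₂` alone govern the sign of `Q` on
positive numbers. -/
theorem factor_of_two_roots {lam ξ e₁ e₂ : ℝ} (h₂ : 0 < e₂) (h : e₂ < e₁)
    (r₁ : quartic lam ξ e₁ = 0) (r₂ : quartic lam ξ e₂ = 0) (t : ℝ) : quartic lam ξ t =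
      (t - e₁) * (t - e₂) * (t ^ 2 + (e₁ + e₂) / (e₁ * e₂) ^ 2 * t + 1 / (e₁ * e₂)) := by
  have h₁ : 0 < e₁ := h₂.trans h
  have hd : e₁ - e₂ ≠ 0 := (sub_pos.2 h).ne'
  unfold quartic at *
  have eA : 4 * lam = (e₁ + e₂) / (e₁ * e₂) ^ 2 - (e₁ + e₂) := by
    rw [eq_sub_iff_add_eq, eq_div_iff (by positivity)]
    refine mul_left_cancel₀ hd ?_
    linear_combination e₂ ^ 2 * r₁ - e₁ ^ 2 * r₂
  have eB : 4 * (lam ^ 2 - ξ ^ 2) = -(e₁ ^ 4 + 4 * lam * e₁ ^ 3 + 1) / e₁ ^ 2 := by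
    rw [eq_div_iff (by positivity)]
    linear_combination r₁
  rw [eB, eA]
  field_simp
  ring

theorem xi_sq {lam e₁ : ℝ} (h : 0 < e₁) :
    4 * xi lam e₁ ^ 2 * e₁ ^ 2 = 1 + (e₁ * (e₁ + 2 * lam)) ^ 2 := by
  have := Real.sq_sqrt (show 0 ≤ 1 + (e₁ * (e₁ + 2 * lam)) ^ 2 by positivity)
  rw [xi, mul_pow, this]
  field_simp
  norm_num

/-- The cubic `Q(t)/(t - e₁)` equals `-1/e₁` at `0` and `2(e₁³(e₁ + 2λ) - 1)/e₁` at `e₁`. The latter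
is positive because `e₁ > η_λ`, so the second root lies below `e₁`. -/
theorem roots_eTwo {lam e₁ : ℝ} (h : eta lam < e₁) : Roots lam (xi lam e₁) e₁ (eTwo lam e₁) := by
  obtain ⟨η0, η1⟩ := eta_spec lam
  have h₁ : 0 < e₁ := η0.trans h
  have η2 : 0 < eta lam + 2 * lam := pos_of_mul_pos_right (η1 ▸ one_pos) (by positivity)
  have htop : 0 < e₁ + 2 * lam := by linarith
  have hbig : 1 < e₁ ^ 3 * (e₁ + 2 * lam) := by rw [← η1]; exact cube_mul_lt η0 η2 h
  have hxi : 0 < xi lam e₁ := by unfold xi; positivity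
  have hx := xi_sq (lam := lam) h₁
  set ξ := xi lam e₁ with hξ
  have r₁ : quartic lam ξ e₁ = 0 := by unfold quartic; linear_combination -hx
  -- the cubic `Q(t) / (t - e₁)`
  obtain ⟨e₂, he₂, hc₂⟩ : ∃ e₂ ∈ Set.Ioo 0 e₁, e₂ ^ 3 + (4 * lam + e₁) * e₂ ^ 2
      - e₂ / e₁ ^ 2 - 1 / e₁ = 0 := by
    have hc : Continuous fun t : ℝ => t ^ 3 + (4 * lam + e₁) * t ^ 2 - t / e₁ ^ 2 - 1 / e₁ := by
      fun_prop
    refine intermediate_value_Ioo h₁.le hc.continuousOn ⟨?_, ?_⟩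
    · simpa using h₁
    · have : e₁ ^ 3 + (4 * lam + e₁) * e₁ ^ 2 - e₁ / e₁ ^ 2 - 1 / e₁
          = 2 * (e₁ ^ 3 * (e₁ + 2 * lam) - 1) / e₁ := by field_simp; ring
      rw [this]
      have : 0 < e₁ ^ 3 * (e₁ + 2 * lam) - 1 := by linarith
      positivity
  have r₂ : quartic lam ξ e₂ = 0 := by
    have : quartic lam ξ e₂ = (e₂ - e₁) * (e₂ ^ 3 + (4 * lam + e₁) * e₂ ^ 2
      - e₂ / e₁ ^ 2 - 1 / e₁) := by
      have eB : 4 * (lam ^ 2 - ξ ^ 2) = -(e₁ ^ 4 + 4 * lam * e₁ ^ 3 + 1) / e₁ ^ 2 := by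
        rw [eq_div_iff (by positivity)]
        unfold quartic at r₁
        linear_combination r₁
      unfold quartic
      rw [eB]
      field_simp
      ring
    rw [this, hc₂, mul_zero]
  have hR : Roots lam ξ e₁ e₂ := ⟨hxi, he₂.1, he₂.2, htop, factor_of_two_roots he₂.1 he₂.2 r₁ r₂⟩
  have hset : {t : ℝ | 0 < t ∧ quartic lam ξ t = 0} = {e₂, e₁} := by
    ext t
    simp only [Set.mem_ofPred_eq, Set.mem_insert_iff, Set.mem_singleton_iff]
    constructor
    · rintro ⟨ht, h⟩
      exact ((hR.eq_zero_iff ht).1 h).symm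
    · rintro (rfl | rfl)
      · exact ⟨he₂.1, r₂⟩
      · exact ⟨h₁, r₁⟩
  have : eTwo lam e₁ = e₂ := by
    rw [eTwo, ← hξ, hset, csInf_pair, inf_eq_left.2 he₂.2.le]
  rwa [this]

/-- `Q(-2λ) = 1 - 16ξ²λ²`, and `-2λ < e₁`; the sign of `Q` at `-2λ` therefore locates `-2λ` relative
to `e₂`. -/
theorem Roots.lt_neg_two_mul_iff {lam ξ e₁ e₂ : ℝ} (hr : Roots lam ξ e₁ e₂) (hlam : lam < 0) :
    (e₂ < -2 * lam ↔ 1 < 16 * ξ ^ 2 * lam ^ 2) ∧ (e₂ = -2 * lam ↔ 16 * ξ ^ 2 * lam ^ 2 = 1) := by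
  have h0 : 0 < -2 * lam := by linarith
  have hq : quartic lam ξ (-2 * lam) = 1 - 16 * ξ ^ 2 * lam ^ 2 := by unfold quartic; ring
  have h1 := hr.mem_Icc h0
  have h2 := hr.eq_zero_iff h0
  have htop := hr.top_pos
  rw [hq] at h1 h2
  have h3 : (16 * ξ ^ 2 * lam ^ 2 = 1 ↔ e₂ = -2 * lam) := by
    rw [eq_comm (a := e₂), ← or_iff_right (a := -2 * lam = e₁) (b := -2 * lam = e₂)
      (by intro e; linarith), ← h2, sub_eq_zero, eq_comm]
  refine ⟨?_, h3.symm⟩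
  constructor
  · intro h
    have := h1.2 ⟨h.le, by linarith⟩
    exact lt_of_le_of_ne (by linarith) fun e => h.ne (h3.1 e.symm)
  · intro h
    exact lt_of_le_of_ne (h1.1 (by linarith)).1 fun e => h.ne' (h3.2 e)

/-- The half-line `t > -2λ` suffices: it contains `e₁`, and any positive root of the cubic lies on
it. -/
theorem exists_exceptional_root {lam : ℝ} (hlam : lam < 0) : ∃ u : ℝ,
    exceptional lam = (u : EReal) ∧ ∀ t, 0 < t + 2 * lam →
      (t < u ↔ 4 * lam ^ 2 * t ^ 3 + 8 * lam ^ 3 * t ^ 2 - t + 2 * lam < 0) ∧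
      (t = u ↔ 4 * lam ^ 2 * t ^ 3 + 8 * lam ^ 3 * t ^ 2 - t + 2 * lam = 0) := by
  -- for positive `t` the sign of the cubic is that of `4λ²t² + 8λ³t - 1 + 2λ/t`
  let g : ℝ → ℝ := fun t => 4 * lam ^ 2 * t * (t + 2 * lam) - 1 + 2 * lam / t
  have hg : ∀ t, 0 < t → 4 * lam ^ 2 * t ^ 3 + 8 * lam ^ 3 * t ^ 2 - t + 2 * lam = t * g t := by
    intro t ht
    simp only [g]
    field_simp
    ring
  have hmono : ∀ s t, 0 < s + 2 * lam → s < t → g s < g t := by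
    intro s t hs hst
    have s0 : 0 < s := by linarith
    have h1 : s * (s + 2 * lam) < t * (t + 2 * lam) := by nlinarith
    have h2 : 2 * lam / s < 2 * lam / t := by
      rw [div_lt_div_iff₀ s0 (s0.trans hst)]; nlinarith
    have h3 : 0 < lam ^ 2 := by nlinarith
    simp only [g]
    nlinarith
  have hpos : ∀ t, 0 < t →
      4 * lam ^ 2 * t ^ 3 + 8 * lam ^ 3 * t ^ 2 - t + 2 * lam = 0 → 0 < t + 2 * lam := by
    intro t ht h
    by_contra! hcon
    have : 0 < lam ^ 2 := by nlinarith
    have : lam ^ 2 * t ^ 2 * (t + 2 * lam) ≤ 0 :=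
      mul_nonpos_of_nonneg_of_nonpos (by positivity) hcon
    nlinarith
  obtain ⟨u, hu, hgu⟩ : ∃ u : ℝ, 0 < u + 2 * lam ∧ g u = 0 := by
    -- Here `M + 2λ = 1/λ²`, so that `4λ²M(M + 2λ) = 4M`; at the other end `g(-2λ) = -2`.
    let M : ℝ := -2 * lam + 1 / lam ^ 2
    have hM : -2 * lam ≤ M := by simp only [M]; have := sq_nonneg lam; linarith [one_div_nonneg.2 this]
    have hc : ContinuousOn g (Set.Icc (-2 * lam) M) := by
      refine ContinuousOn.add (by fun_prop) (continuousOn_const.div continuousOn_id fun t ht => ?_)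
      exact (by linarith [ht.1] : (0 : ℝ) < t).ne'
    have hl2 : 0 < lam ^ 2 := by nlinarith
    obtain ⟨u, hu, h⟩ := intermediate_value_Icc hM hc (show (0 : ℝ) ∈ Set.Icc _ _ from ⟨by
      simp only [g]
      have : 2 * lam / (-2 * lam) = -1 := by field_simp [hlam.ne]
      rw [this]; norm_num, by
      have hMp : 0 < M := by linarith
      have h1 : M + 2 * lam = 1 / lam ^ 2 := by simp only [M]; ring
      have h2 : -1 ≤ 2 * lam / M := by rw [le_div_iff₀ hMp]; linarith
      have h3 : 4 * lam ^ 2 * M * (M + 2 * lam) = 4 * M := by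
        have hne := hlam.ne
        rw [h1]; field_simp
      simp only [g]
      rw [h3]
      have h5 : 2 ≤ 4 * M := by
        by_contra! hcon
        have h6 : 1 / lam ^ 2 < 1 / 2 := by simp only [M] at hcon hM; linarith
        rw [one_div_lt_one_div hl2 (by norm_num)] at h6
        nlinarith
      linarith⟩)
    refine ⟨u, lt_of_le_of_ne (by linarith [hu.1]) fun e => ?_, h⟩
    have : u = -2 * lam := by linarith
    rw [this] at h
    simp only [g] at h
    have : 2 * lam / (-2 * lam) = -1 := by field_simp [hlam.ne]
    rw [this] at h
    norm_num at h
  have u0 : 0 < u := by linarith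
  have hset : {t : ℝ | 0 < t ∧
      4 * lam ^ 2 * t ^ 3 + 8 * lam ^ 3 * t ^ 2 - t + 2 * lam = 0} = {u} := by
    refine Set.eq_singleton_iff_unique_mem.2 ⟨⟨u0, by rw [hg u u0, hgu, mul_zero]⟩, ?_⟩
    rintro t ⟨ht, h⟩
    have htp := hpos t ht h
    rw [hg t ht, mul_eq_zero, or_iff_right ht.ne'] at h
    rcases lt_trichotomy t u with e | e | e
    · linarith [hmono t u htp e]
    · exact e
    · linarith [hmono u t hu e]
  refine ⟨u, by rw [exceptional, if_pos hlam, hset, csInf_singleton], fun t ht => ?_⟩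
  have t0 : 0 < t := by linarith
  rw [hg t t0, mul_eq_zero, or_iff_right t0.ne', mul_neg_iff_of_pos t0]
  rcases lt_trichotomy t u with e | e | e
  · have := hmono t u ht e
    exact ⟨⟨fun _ => by linarith, fun _ => e⟩, ⟨fun h => absurd h e.ne, fun h => by linarith⟩⟩
  · subst e
    exact ⟨⟨fun h => absurd h (lt_irrefl _), fun h => by linarith⟩, ⟨fun _ => hgu, fun _ => rfl⟩⟩
  · have := hmono u t hu e
    exact ⟨⟨fun h => absurd h e.le.not_gt, fun _ => by linarith⟩,
      ⟨fun h => absurd h e.ne', fun h => by linarith⟩⟩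

/-- The trichotomy `e₁ < u_λ`, `e₁ = u_λ`, `e₁ > u_λ` in terms of the smaller root. -/
theorem exceptional_cases {lam e₁ : ℝ} (h : eta lam < e₁) :
    ((e₁ : EReal) < exceptional lam ↔ 0 < eTwo lam e₁ + 2 * lam) ∧
    ((e₁ : EReal) = exceptional lam ↔ eTwo lam e₁ + 2 * lam = 0) ∧
    (exceptional lam < (e₁ : EReal) ↔ eTwo lam e₁ + 2 * lam < 0) := by
  have hr := roots_eTwo h
  have h₁ : 0 < e₁ := hr.pos.trans hr.lt
  rcases lt_or_ge lam 0 with hlam | hlam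
  · obtain ⟨u, hu, hiff⟩ := exists_exceptional_root hlam
    have htop := hr.top_pos
    obtain ⟨a1, a2⟩ := hiff e₁ htop
    obtain ⟨b1, b2⟩ := hr.lt_neg_two_mul_iff hlam
    -- By the definition of `ξ`, the cubic at `e₁` has the sign of `16ξ²λ² - 1 = -Q(-2λ)`. This is
    -- the link between `u_λ` and the position of `e₂` relative to `-2λ`.
    have key : (e₁ + 2 * lam) *
        (4 * lam ^ 2 * e₁ ^ 3 + 8 * lam ^ 3 * e₁ ^ 2 - e₁ + 2 * lam)
        = e₁ ^ 2 * (16 * xi lam e₁ ^ 2 * lam ^ 2 - 1) := by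
      linear_combination (-4 * lam ^ 2) * xi_sq (lam := lam) h₁
    have k1 : 4 * lam ^ 2 * e₁ ^ 3 + 8 * lam ^ 3 * e₁ ^ 2 - e₁ + 2 * lam < 0 ↔
        16 * xi lam e₁ ^ 2 * lam ^ 2 - 1 < 0 := by
      rw [← mul_neg_iff_of_pos htop, key, mul_neg_iff_of_pos (by positivity)]
    have k2 : 4 * lam ^ 2 * e₁ ^ 3 + 8 * lam ^ 3 * e₁ ^ 2 - e₁ + 2 * lam = 0 ↔
        16 * xi lam e₁ ^ 2 * lam ^ 2 - 1 = 0 := by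
      rw [← mul_eq_zero_iff_of_pos htop, key, mul_eq_zero_iff_of_pos (by positivity)]
    rw [k1] at a1
    rw [k2] at a2
    rw [hu, EReal.coe_lt_coe_iff, EReal.coe_lt_coe_iff, EReal.coe_eq_coe_iff]
    have c2 : e₁ = u ↔ eTwo lam e₁ + 2 * lam = 0 := by
      rw [a2, sub_eq_zero, ← b2]; constructor <;> intro h <;> linarith
    have c3 : u < e₁ ↔ eTwo lam e₁ + 2 * lam < 0 := by
      have : eTwo lam e₁ + 2 * lam < 0 ↔ eTwo lam e₁ < -2 * lam := by
        constructor <;> intro h <;> linarith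
      rw [this, b1]
      constructor
      · intro hlt
        have n1 := fun h => (a1.2 h).not_gt hlt
        have n2 := fun h => (a2.2 h).not_gt hlt
        exact lt_of_not_ge fun hh => (hh.lt_or_eq).elim (fun h => n1 (by linarith))
          fun h => n2 (by linarith)
      · intro hlt
        have n1 := fun h => (a1.1 h)
        have n2 := fun h => (a2.1 h)
        exact lt_of_not_ge fun hh => (hh.lt_or_eq).elim (fun h => by linarith [n1 h])
          fun h => by linarith [n2 h]
    refine ⟨?_, c2, c3⟩
    constructor
    · intro h
      by_contra! hcon
      rcases hcon.lt_or_eq with h' | h'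
      · exact h.not_gt (c3.2 h')
      · exact h.ne (c2.2 h')
    · intro h
      by_contra! hcon
      rcases hcon.lt_or_eq with h' | h'
      · linarith [c3.1 h']
      · linarith [c2.1 h'.symm]
  · have hp : 0 < eTwo lam e₁ + 2 * lam := by linarith [hr.pos]
    rw [exceptional, if_neg hlam.not_gt]
    simp [hp, hp.ne', hp.le]


/-! ### Least periods -/

theorem leastPeriod_eq {α : Type*} {f : ℝ → α} {τ : ℝ} (hτ : 0 < τ)
    (h : ∀ T, Function.Periodic f T ↔ ∃ k : ℤ, T = k * τ) : leastPeriod f = τ := by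
  refine IsLeast.csInf_eq ⟨⟨hτ, (h τ).2 ⟨1, by simp⟩⟩, fun T hT => ?_⟩
  obtain ⟨hT0, hT⟩ := hT
  obtain ⟨k, rfl⟩ := (h T).1 hT
  have hk : (0 : ℝ) < k := pos_of_mul_pos_left hT0 hτ.le
  have hk1 : (1 : ℝ) ≤ k := by exact_mod_cast hk
  nlinarith

/-- The periods form a subgroup of `ℝ`, which is dense or cyclic; a continuous function with a dense
group of periods is constant. -/
theorem periodic_iff_leastPeriod {α : Type*} [TopologicalSpace α] [T2Space α] {f : ℝ → α}
    (hf : Continuous f) (hper : ∃ T, 0 < T ∧ Function.Periodic f T)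
    (hnc : ¬ ∀ s t, f s = f t) :
    0 < leastPeriod f ∧ ∀ T, Function.Periodic f T ↔ ∃ k : ℤ, T = k * leastPeriod f := by
  let S : AddSubgroup ℝ :=
    { carrier := {T | Function.Periodic f T}
      add_mem' := fun ha hb => ha.add_period hb
      zero_mem' := fun s => by simp
      neg_mem' := fun ha => ha.neg }
  have hS : ∀ T, T ∈ S ↔ Function.Periodic f T := fun T => Iff.rfl
  rcases AddSubgroup.dense_or_cyclic S with hd | ⟨a, ha⟩
  · refine absurd (fun s t => ?_) hnc
    have hcl : IsClosed {T : ℝ | f (s + T) = f s} :=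
      isClosed_eq (hf.comp (continuous_const.add continuous_id)) continuous_const
    have hsub : (S : Set ℝ) ⊆ {T : ℝ | f (s + T) = f s} := fun T hT => (hS T).1 hT s
    have := hcl.closure_subset_iff.2 hsub (hd (t - s))
    simpa using Eq.symm this
  · obtain ⟨T, hT0, hT⟩ := hper
    have hmem : ∀ T, Function.Periodic f T ↔ ∃ k : ℤ, T = k * |a| := by
      intro T
      rw [← hS, ha, AddSubgroup.mem_closure_singleton]
      constructor
      · rintro ⟨k, rfl⟩
        rcases abs_choice a with h | h
        · exact ⟨k, by rw [h, zsmul_eq_mul]⟩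
        · exact ⟨-k, by rw [h, zsmul_eq_mul]; push_cast; ring⟩
      · rintro ⟨k, rfl⟩
        rcases abs_choice a with h | h
        · exact ⟨k, by rw [h, zsmul_eq_mul]⟩
        · exact ⟨-k, by rw [h, zsmul_eq_mul]; push_cast; ring⟩
    have ha0 : 0 < |a| := by
      rw [abs_pos]
      rintro rfl
      obtain ⟨k, hk⟩ := (hmem T).1 hT
      simp at hk
      exact hT0.ne' hk
    rw [leastPeriod_eq ha0 hmem]
    exact ⟨ha0, hmem⟩

/-! ### The differential equation of the invariant `μ` -/

/-- The right-hand side of the equation `μ'' = force μ`, obtained by differentiating the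
conservation law `(μ')² = -μ² Q(μ)`. -/
def force (lam ξ t : ℝ) : ℝ :=
  -(3 * t ^ 5 + 10 * lam * t ^ 4 + 8 * (lam ^ 2 - ξ ^ 2) * t ^ 3 + t)

/-- The force is `-(tQ + t²Q'/2)`, and the positive roots of `Q` are simple: a turning point of `μ`
is never an equilibrium. -/
theorem Roots.force_ne_zero {lam ξ e₁ e₂ t : ℝ} (hr : Roots lam ξ e₁ e₂) (ht : 0 < t)
    (h : quartic lam ξ t = 0) : force lam ξ t ≠ 0 := by
  set b := (e₁ + e₂) / (e₁ * e₂) ^ 2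
  set c := 1 / (e₁ * e₂)
  have hc := hr.cofactor_pos ht
  have hlt := hr.lt
  have hd : ∀ s, HasDerivAt (quartic lam ξ)
      (4 * s ^ 3 + 12 * lam * s ^ 2 + 8 * (lam ^ 2 - ξ ^ 2) * s) s := by
    intro s
    have := ((((hasDerivAt_pow 4 s).add ((hasDerivAt_pow 3 s).const_mul (4 * lam))).add
      ((hasDerivAt_pow 2 s).const_mul (4 * (lam ^ 2 - ξ ^ 2)))).add_const 1)
    refine this.congr_deriv ?_
    push_cast; ring
  have hd' : HasDerivAt (quartic lam ξ) (((t - e₂) + (t - e₁)) * (t ^ 2 + b * t + c)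
      + (t - e₁) * (t - e₂) * (2 * t + b)) t := by
    rw [show quartic lam ξ = _ from funext hr.factor]
    have := ((((hasDerivAt_id t).sub_const e₁).mul ((hasDerivAt_id t).sub_const e₂)).mul
      (((hasDerivAt_pow 2 t).add ((hasDerivAt_id t).const_mul b)).add_const c))
    refine this.congr_deriv ?_
    simp
  have heq := (hd t).unique hd'
  have hf : force lam ξ t = -(t * quartic lam ξ t + t ^ 2 / 2 *
      (4 * t ^ 3 + 12 * lam * t ^ 2 + 8 * (lam ^ 2 - ξ ^ 2) * t)) := by
    unfold force quartic; ring
  rw [hf, h, heq]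
  rcases (hr.eq_zero_iff ht).1 h with e | e
  · have : 0 < t ^ 2 / 2 * ((t - e₂) * (t ^ 2 + b * t + c)) := by
      have : 0 < t - e₂ := by linarith
      positivity
    rw [e] at this ⊢
    nlinarith
  · have : 0 < t ^ 2 / 2 * ((e₁ - t) * (t ^ 2 + b * t + c)) := by
      have : 0 < e₁ - t := by linarith
      positivity
    rw [e] at this ⊢
    nlinarith

/-- A positive `C²` solution of the conservation law with simple roots is constant or solves the
second order equation. -/
theorem deriv_deriv_eq_force {lam ξ e₁ e₂ : ℝ} (hr : Roots lam ξ e₁ e₂) {μ : ℝ → ℝ}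
    (hμ : ContDiff ℝ 2 μ) (pos : ∀ s, 0 < μ s)
    (energy : ∀ s, deriv μ s ^ 2 = -(μ s ^ 2 * quartic lam ξ (μ s)))
    (hnc : ¬ ∀ s t, μ s = μ t) (s : ℝ) : HasDerivAt (deriv μ) (force lam ξ (μ s)) s := by
  have hd : ContDiff ℝ 1 (deriv μ) := by
    have : ContDiff ℝ (1 + 1) μ := by simpa [one_add_one_eq_two] using hμ
    exact (contDiff_succ_iff_deriv.1 this).2.2
  have d1 : ∀ s, HasDerivAt μ (deriv μ s) s := fun s =>
    (hμ.differentiable (by norm_num) s).hasDerivAt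
  have d2 : ∀ s, HasDerivAt (deriv μ) (deriv (deriv μ) s) s := fun s =>
    (hd.differentiable (by norm_num) s).hasDerivAt
  have cdd : Continuous (deriv (deriv μ)) := hd.continuous_deriv (by norm_num)
  have cf : Continuous fun s => force lam ξ (μ s) := by
    have := hμ.continuous
    unfold force; fun_prop
  -- Differentiating the conservation law yields the second order equation only up to the factor
  -- `μ'`.
  have key : ∀ s, deriv μ s * (deriv (deriv μ) s - force lam ξ (μ s)) = 0 := by
    intro s
    have h1 := (d2 s).pow 2
    have h2 : HasDerivAt (fun s => -(μ s ^ 2 * quartic lam ξ (μ s)))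
        (2 * force lam ξ (μ s) * deriv μ s) s := by
      have := ((((((d1 s).pow 6).add (((d1 s).pow 5).const_mul (4 * lam))).add
        (((d1 s).pow 4).const_mul (4 * (lam ^ 2 - ξ ^ 2)))).add ((d1 s).pow 2))).neg
      have e : (fun s => -(μ s ^ 2 * quartic lam ξ (μ s))) = -(μ ^ 6 +
          (fun s => 4 * lam * (μ ^ 5) s) + (fun s => 4 * (lam ^ 2 - ξ ^ 2) * (μ ^ 4) s) + μ ^ 2) := by
        ext s; simp [quartic]; ring
      rw [e]
      refine this.congr_deriv ?_
      unfold force; push_cast; ring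
    have h3 : (deriv μ) ^ 2 = fun s => -(μ s ^ 2 * quartic lam ξ (μ s)) := funext energy
    rw [h3] at h1
    have := h1.unique h2
    push_cast at this
    linear_combination this / 2
  -- Where the equation fails, an open condition, `μ'` and hence `μ''` vanish. These vanish on the
  -- closure too, where the force is then nonzero, so the equation still fails. The set is thus
  -- clopen: it is empty, or all of `ℝ` and `μ` is constant.
  let B : Set ℝ := {s | deriv (deriv μ) s - force lam ξ (μ s) ≠ 0}
  have hBo : IsOpen B := isOpen_ne_fun (cdd.sub cf) continuous_const
  have hB0 : ∀ s ∈ B, deriv μ s = 0 := fun s hs => (mul_eq_zero.1 (key s)).resolve_right hs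
  have hB1 : ∀ s ∈ B, deriv (deriv μ) s = 0 := by
    intro s hs
    have : deriv μ =ᶠ[nhds s] fun _ => 0 := Filter.eventually_of_mem (hBo.mem_nhds hs) hB0
    rw [this.deriv_eq]; simp
  have hBc : IsClosed B := by
    rw [← closure_subset_iff_isClosed]
    intro s hs
    have e0 : deriv μ s = 0 := by
      have hc : IsClosed {s | deriv μ s = 0} := isClosed_eq hd.continuous continuous_const
      exact hc.closure_subset_iff.2 hB0 hs
    have e1 : deriv (deriv μ) s = 0 := by
      have hc : IsClosed {s | deriv (deriv μ) s = 0} := isClosed_eq cdd continuous_const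
      exact hc.closure_subset_iff.2 hB1 hs
    have hq : quartic lam ξ (μ s) = 0 := by
      have := energy s
      rw [e0] at this
      have h2 := pow_pos (pos s) 2
      have h3 : μ s ^ 2 * quartic lam ξ (μ s) = 0 := by linarith
      exact (mul_eq_zero.1 h3).resolve_left h2.ne'
    show deriv (deriv μ) s - force lam ξ (μ s) ≠ 0
    rw [e1, zero_sub, neg_ne_zero]
    exact hr.force_ne_zero (pos s) hq
  rcases isClopen_iff.1 ⟨hBc, hBo⟩ with h | h
  · have hs : s ∉ B := by rw [h]; exact Set.notMem_empty s
    have : deriv (deriv μ) s - force lam ξ (μ s) = 0 := not_not.1 hs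
    rw [← sub_eq_zero.1 this]
    exact d2 s
  · refine absurd (fun s t => ?_) hnc
    exact is_const_of_deriv_eq_zero (hμ.differentiable (by norm_num))
      (fun r => hB0 r (h ▸ Set.mem_univ r)) s t

/-- Uniqueness for a second order equation. The force is polynomial and only locally Lipschitz, so
both solutions are confined to a compact interval. -/
theorem eq_of_force {lam ξ a b : ℝ} {f g df dg : ℝ → ℝ}
    (hf : ∀ s, HasDerivAt f (df s) s) (hf' : ∀ s, HasDerivAt df (force lam ξ (f s)) s)
    (hg : ∀ s, HasDerivAt g (dg s) s) (hg' : ∀ s, HasDerivAt dg (force lam ξ (g s)) s)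
    (mf : ∀ s, f s ∈ Set.Icc a b) (mg : ∀ s, g s ∈ Set.Icc a b) {t : ℝ} (h : f t = g t)
    (h' : df t = dg t) : f = g := by
  obtain ⟨K, hK⟩ : ∃ K : NNReal, LipschitzOnWith K (force lam ξ) (Set.Icc a b) := by
    have hc : ContDiff ℝ 1 (force lam ξ) := by unfold force; fun_prop
    obtain ⟨K, hK⟩ := isCompact_Icc.exists_bound_of_continuousOn (s := Set.Icc a b)
      (hc.continuous_deriv (by norm_num)).continuousOn
    refine ⟨K.toNNReal, (convex_Icc a b).lipschitzOnWith_of_nnnorm_deriv_le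
      (fun x _ => hc.differentiable (by norm_num) x) fun x hx => ?_⟩
    rw [← NNReal.coe_le_coe, coe_nnnorm]
    exact (hK x hx).trans (Real.le_coe_toNNReal K)
  have hL : LipschitzOnWith (max 1 (K * 1)) (fun p : ℝ × ℝ => (p.2, force lam ξ p.1))
      (Set.Icc a b ×ˢ Set.univ) :=
    LipschitzWith.prod_snd.lipschitzOnWith.prodMk
      (hK.comp LipschitzWith.prod_fst.lipschitzOnWith fun p hp => hp.1)
  have := ODE_solution_unique_univ (v := fun _ p => (p.2, force lam ξ p.1))
    (s := fun _ => Set.Icc a b ×ˢ Set.univ) (f := fun s => (f s, df s))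
    (g := fun s => (g s, dg s)) (t₀ := t) (fun _ => hL)
    (fun s => ⟨(hf s).prodMk (hf' s), mf s, Set.mem_univ _⟩)
    (fun s => ⟨(hg s).prodMk (hg' s), mg s, Set.mem_univ _⟩) (by simp [h, h'])
  funext s
  exact congrArg Prod.fst (congrFun this s)

/-- The `μ`-invariant of a B-curve with parameters `(λ, e₁)`, normalized to have its maximum in the
middle of the period `[0, ω]`. -/
structure Profile (lam ξ e₁ e₂ ω : ℝ) (μ dμ : ℝ → ℝ) : Prop extends Roots lam ξ e₁ e₂ where
  omega_pos : 0 < ω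
  deriv_mu : ∀ s, HasDerivAt μ (dμ s) s
  deriv_dmu : ∀ s, HasDerivAt dμ (force lam ξ (μ s)) s
  mu_pos : ∀ s, 0 < μ s
  energy : ∀ s, dμ s ^ 2 = -(μ s ^ 2 * quartic lam ξ (μ s))
  period_iff : ∀ T, Function.Periodic μ T ↔ ∃ k : ℤ, T = k * ω
  mid : μ (ω / 2) = e₁

/-! ### Symmetries and level sets of the invariant `μ` -/

namespace Profile

variable {lam ξ e₁ e₂ ω : ℝ} {μ dμ : ℝ → ℝ} (P : Profile lam ξ e₁ e₂ ω μ dμ)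
include P

theorem continuous : Continuous μ := continuous_iff_continuousAt.2 fun s => (P.deriv_mu s).continuousAt

theorem mem_Icc (s : ℝ) : μ s ∈ Set.Icc e₂ e₁ := by
  rw [← P.toRoots.mem_Icc (P.mu_pos s)]
  by_contra! h
  have := mul_pos (pow_pos (P.mu_pos s) 2) h
  have := P.energy s
  nlinarith [sq_nonneg (dμ s)]

theorem dmu_eq_zero_iff (s : ℝ) : dμ s = 0 ↔ μ s = e₁ ∨ μ s = e₂ := by
  rw [← P.toRoots.eq_zero_iff (P.mu_pos s), ← sq_eq_zero_iff, P.energy, neg_eq_zero,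
    mul_eq_zero, or_iff_right (pow_pos (P.mu_pos s) 2).ne']

/-- The reflected function solves the same autonomous equation with the same data at the critical
point `a`. -/
theorem reflect {a : ℝ} (ha : dμ a = 0) (s : ℝ) : μ (2 * a - s) = μ s := by
  have := eq_of_force (f := fun s => μ (2 * a - s)) (df := fun s => -dμ (2 * a - s))
    (lam := lam) (ξ := ξ) (t := a)
    (fun s => (P.deriv_mu _).comp_const_sub (2 * a) s)
    (fun s => by simpa using ((P.deriv_dmu _).comp_const_sub (2 * a) s).fun_neg) P.deriv_mu P.deriv_dmu
    (fun s => P.mem_Icc _) P.mem_Icc (by simp [two_mul]) (by simp [two_mul, ha])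
  exact congrFun this s

theorem dmu_mid : dμ (ω / 2) = 0 := (P.dmu_eq_zero_iff _).2 (Or.inl P.mid)

theorem periodic : Function.Periodic μ ω := (P.period_iff ω).2 ⟨1, by simp⟩

theorem periodic_int (j : ℤ) : Function.Periodic μ (j * ω) := (P.period_iff _).2 ⟨j, rfl⟩

theorem even (s : ℝ) : μ (-s) = μ s := by
  rw [← P.reflect P.dmu_mid, show 2 * (ω / 2) - -s = s + ω by ring, P.periodic]

theorem mu_omega_sub (s : ℝ) : μ (ω - s) = μ s := by
  rw [← P.reflect P.dmu_mid]; ring_nf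

/-- The reflections at `a` and at `ω/2` compose to the translation by `2a - ω`, which must be a
period. -/
theorem exists_of_dmu_eq_zero {a : ℝ} (ha : dμ a = 0) : ∃ k : ℤ, a = k * (ω / 2) := by
  obtain ⟨k, hk⟩ := (P.period_iff (2 * a - ω)).1 fun s => by
    rw [← P.reflect P.dmu_mid s, ← P.reflect ha]; ring_nf
  exact ⟨k + 1, by push_cast; linarith⟩

theorem dmu_omega_sub (s : ℝ) : dμ (ω - s) = -dμ s := by
  have h := (P.deriv_mu (ω - s)).comp_const_sub ω s
  rw [show (fun s => μ (ω - s)) = μ from funext P.mu_omega_sub] at h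
  rw [(P.deriv_mu s).unique h, neg_neg]

theorem dmu_add_omega (s : ℝ) : dμ (s + ω) = dμ s := by
  have h := (P.deriv_mu (s + ω)).comp_add_const s ω
  rw [show (fun s => μ (s + ω)) = μ from funext P.periodic] at h
  exact h.unique (P.deriv_mu s)

theorem dmu_zero : dμ 0 = 0 := by
  have h1 := P.dmu_omega_sub 0
  have h2 := P.dmu_add_omega 0
  rw [sub_zero] at h1
  rw [zero_add] at h2
  linarith

theorem mu_zero : μ 0 = e₂ := by
  refine ((P.dmu_eq_zero_iff 0).1 P.dmu_zero).resolve_left fun h => ?_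
  have hω := P.omega_pos
  -- If `μ 0` were also the maximum, then translation by `ω/2` would preserve the initial data, and
  -- `ω/2` would be a period.
  have : (fun s => μ (s + ω / 2)) = μ := eq_of_force (df := fun s => dμ (s + ω / 2))
    (lam := lam) (ξ := ξ) (t := 0)
    (fun s => by simpa using (P.deriv_mu (s + ω / 2)).comp_add_const s (ω / 2))
    (fun s => by simpa using (P.deriv_dmu (s + ω / 2)).comp_add_const s (ω / 2))
    P.deriv_mu P.deriv_dmu
    (fun s => P.mem_Icc _) P.mem_Icc (by simp [h, P.mid]) (by simp [P.dmu_mid, P.dmu_zero])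
  obtain ⟨k, hk⟩ := (P.period_iff (ω / 2)).1 (congrFun this)
  have h2 : ((2 * k : ℤ) : ℝ) = (1 : ℤ) := by
    push_cast
    have : (2 * k - 1) * ω = 0 := by linarith
    linarith [(mul_eq_zero.1 this).resolve_right hω.ne']
  have := Int.cast_injective h2
  omega

theorem dmu_ne_zero {s : ℝ} (hs : s ∈ Set.Ioo 0 (ω / 2)) : dμ s ≠ 0 := by
  intro h
  obtain ⟨k, rfl⟩ := P.exists_of_dmu_eq_zero h
  have hω : 0 < ω / 2 := half_pos P.omega_pos
  have h1 : (0 : ℝ) < k := pos_of_mul_pos_left hs.1 hω.le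
  have h2 : (k : ℝ) < 1 := by nlinarith [hs.2]
  have h1' : 0 < k := by exact_mod_cast h1
  have h2' : k < 1 := by exact_mod_cast h2
  omega

theorem dmu_pos {s : ℝ} (hs : s ∈ Set.Ioo 0 (ω / 2)) : 0 < dμ s := by
  have hω : 0 < ω / 2 := half_pos P.omega_pos
  have cd : Continuous dμ := continuous_iff_continuousAt.2 fun s => (P.deriv_dmu s).continuousAt
  obtain ⟨r, hr, hr'⟩ := exists_hasDerivAt_eq_slope μ dμ hω P.continuous.continuousOn
    fun s _ => P.deriv_mu s
  have hpos : 0 < dμ r := by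
    rw [hr', P.mid, P.mu_zero]
    exact div_pos (sub_pos.2 P.lt) (by linarith)
  by_contra! hcon
  obtain ⟨t, ht, h0⟩ := isPreconnected_Ioo.intermediate_value hs hr cd.continuousOn ⟨hcon, hpos.le⟩
  exact P.dmu_ne_zero ht h0

theorem strictMonoOn : StrictMonoOn μ (Set.Icc 0 (ω / 2)) := by
  refine strictMonoOn_of_deriv_pos (convex_Icc _ _) P.continuous.continuousOn fun s hs => ?_
  rw [interior_Icc] at hs
  rw [(P.deriv_mu s).deriv]
  exact P.dmu_pos hs

theorem exists_reduce (s : ℝ) : ∃ (j : ℤ) (r : ℝ), r ∈ Set.Ico 0 ω ∧ s = r + j * ω := by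
  refine ⟨⌊s / ω⌋, s - ⌊s / ω⌋ * ω, ⟨?_, ?_⟩, by ring⟩
  · have := Int.floor_le (s / ω)
    rw [le_div_iff₀ P.omega_pos] at this
    linarith
  · have := Int.lt_floor_add_one (s / ω)
    rw [div_lt_iff₀ P.omega_pos] at this
    linarith

/-- Every parameter is congruent, modulo the period, to one in `[0, ω / 2]` up to sign. -/
theorem exists_reduce_half (s : ℝ) : ∃ (j : ℤ) (r : ℝ), r ∈ Set.Icc 0 (ω / 2) ∧
    (s = r + j * ω ∨ s = -r + j * ω) := by
  obtain ⟨j, r, hr, rfl⟩ := P.exists_reduce s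
  rcases le_or_gt r (ω / 2) with h | h
  · exact ⟨j, r, ⟨hr.1, h⟩, Or.inl rfl⟩
  · exact ⟨j + 1, ω - r, ⟨by linarith [hr.2], by linarith⟩, Or.inr (by push_cast; ring)⟩

theorem mu_add_int (s : ℝ) (j : ℤ) : μ (s + j * ω) = μ s := P.periodic_int j s

/-- `[0, ω/2]` is a fundamental domain for the group generated by `s ↦ -s` and `s ↦ s + ω`, and `μ`
is injective on it. -/
theorem mu_eq_iff (s t : ℝ) :
    μ s = μ t ↔ ∃ j : ℤ, t = s + j * ω ∨ t = -s + j * ω := by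
  constructor
  · intro h
    obtain ⟨i, r, hr, hs⟩ := P.exists_reduce_half s
    obtain ⟨j, q, hq, ht⟩ := P.exists_reduce_half t
    have e1 : μ s = μ r := by
      rcases hs with rfl | rfl
      · rw [P.mu_add_int]
      · rw [P.mu_add_int, P.even]
    have e2 : μ t = μ q := by
      rcases ht with rfl | rfl
      · rw [P.mu_add_int]
      · rw [P.mu_add_int, P.even]
    have : r = q := P.strictMonoOn.injOn hr hq (by rw [← e1, h, e2])
    subst this
    rcases hs with rfl | rfl <;> rcases ht with rfl | rfl
    · exact ⟨j - i, Or.inl (by push_cast; ring)⟩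
    · exact ⟨j + i, Or.inr (by push_cast; ring)⟩
    · exact ⟨j + i, Or.inr (by push_cast; ring)⟩
    · exact ⟨j - i, Or.inl (by push_cast; ring)⟩
  · rintro ⟨j, rfl | rfl⟩
    · rw [P.mu_add_int]
    · rw [P.mu_add_int, P.even]

end Profile

/-! ### The moving frame of a profile -/

/-- The height `⟨γ, e_x⟩` of the standard B-curve. -/
noncomputable def height (ξ : ℝ) (μ : ℝ → ℝ) (s : ℝ) : ℝ := 1 / (2 * ξ * μ s)

/-- The component `⟨γ', e_x⟩` of the velocity of the standard B-curve. -/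
noncomputable def climb (ξ : ℝ) (μ dμ : ℝ → ℝ) (s : ℝ) : ℝ := -dμ s / (2 * ξ * μ s ^ 2)

/-- The component `⟨γ × γ', e_x⟩` of the angular momentum of the standard B-curve. -/
noncomputable def momentum (lam ξ : ℝ) (μ : ℝ → ℝ) (s : ℝ) : ℝ := (μ s + 2 * lam) / (2 * ξ)

/-- The angle, counted from `ω / 2`, through which the stereographic projection of the standard
B-curve from the lower pole of the `Ox`-axis turns. -/
noncomputable def turn (lam ξ ω : ℝ) (μ : ℝ → ℝ) (s : ℝ) : ℝ :=
  ∫ t in (ω / 2)..s, (μ t ^ 2 + momentum lam ξ μ t / (1 + height ξ μ t))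

/-- The projection to the `(y, z)`-plane of the standard B-curve. -/
noncomputable def planar (lam ξ ω : ℝ) (μ dμ : ℝ → ℝ) (s : ℝ) : ℂ :=
  (-momentum lam ξ μ s + climb ξ μ dμ s * Complex.I) *
    Complex.exp (turn lam ξ ω μ s * Complex.I)

namespace Profile

variable {lam ξ e₁ e₂ ω : ℝ} {μ dμ : ℝ → ℝ} (P : Profile lam ξ e₁ e₂ ω μ dμ)
include P

local notation "H" => height ξ μ
local notation "V" => climb ξ μ dμ
local notation "M" => momentum lam ξ μ
local notation "B" => turn lam ξ ω μ

theorem height_pos (s : ℝ) : 0 < H s := by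
  have := P.mu_pos s
  have := P.xi_pos
  unfold height; positivity

theorem one_add_height_pos (s : ℝ) : 0 < 1 + H s := by linarith [P.height_pos s]

/-- This is the conservation law itself, read as the unit length of the axis vector in the moving
frame. -/
theorem unit (s : ℝ) : H s ^ 2 + V s ^ 2 + M s ^ 2 = 1 := by
  have h1 := (P.mu_pos s).ne'
  have h2 := P.xi_pos.ne'
  have h3 := P.energy s
  simp only [height, climb, momentum, div_pow, neg_sq]
  rw [h3]
  unfold quartic
  field_simp
  ring

theorem deriv_height (s : ℝ) : HasDerivAt H (V s) s := by
  have h1 := (P.mu_pos s).ne'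
  have h2 := P.xi_pos.ne'
  have := ((P.deriv_mu s).const_mul (2 * ξ)).inv (by positivity)
  rw [show H = fun s => (2 * ξ * μ s)⁻¹ from funext fun s => one_div _]
  refine this.congr_deriv ?_
  simp only [climb]
  field_simp

theorem deriv_climb (s : ℝ) : HasDerivAt V (-H s + μ s ^ 2 * M s) s := by
  have h1 := (P.mu_pos s).ne'
  have h2 := P.xi_pos.ne'
  have := (P.deriv_dmu s).neg.div (((P.deriv_mu s).pow 2).const_mul (2 * ξ)) (by
    simp only [Pi.pow_apply]; positivity)
  refine this.congr_deriv ?_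
  simp only [height, momentum, Pi.neg_apply, Pi.pow_apply]
  have h3 := P.energy s
  unfold quartic at h3
  unfold force
  field_simp
  push_cast
  linear_combination 2 * μ s * h3

theorem deriv_momentum (s : ℝ) : HasDerivAt M (-(μ s ^ 2 * V s)) s := by
  have h1 := (P.mu_pos s).ne'
  have h2 := P.xi_pos.ne'
  refine (((P.deriv_mu s).add_const (2 * lam)).div_const (2 * ξ)).congr_deriv ?_
  simp only [climb]
  field_simp

theorem continuous_height : Continuous H :=
  continuous_iff_continuousAt.2 fun s => (P.deriv_height s).continuousAt

theorem continuous_climb : Continuous V :=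
  continuous_iff_continuousAt.2 fun s => (P.deriv_climb s).continuousAt

theorem continuous_momentum : Continuous M :=
  continuous_iff_continuousAt.2 fun s => (P.deriv_momentum s).continuousAt

theorem continuous_turn_integrand : Continuous fun t => μ t ^ 2 + M t / (1 + H t) := by
  have c1 := P.continuous
  have c2 := P.continuous_height
  have c3 := P.continuous_momentum
  have := fun s => (P.one_add_height_pos s).ne'
  fun_prop (disch := assumption)

theorem deriv_turn (s : ℝ) : HasDerivAt B (μ s ^ 2 + M s / (1 + H s)) s :=
  intervalIntegral.integral_hasDerivAt_right
    (P.continuous_turn_integrand.intervalIntegrable _ _)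
    P.continuous_turn_integrand.aestronglyMeasurable.stronglyMeasurableAtFilter
    P.continuous_turn_integrand.continuousAt

theorem continuous_turn : Continuous B :=
  continuous_iff_continuousAt.2 fun s => (P.deriv_turn s).continuousAt

omit P in
theorem turn_mid : B (ω / 2) = 0 := intervalIntegral.integral_same

theorem climb_pos {s : ℝ} (hs : s ∈ Set.Ioo (ω / 2) ω) : 0 < V s := by
  have h1 := P.dmu_omega_sub s
  have h2 := P.dmu_pos (s := ω - s) ⟨by linarith [hs.2], by linarith [hs.1]⟩
  have h3 := P.mu_pos s
  have h4 := P.xi_pos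
  have h5 : 0 < -dμ s := by linarith
  unfold climb; positivity

theorem climb_neg {s : ℝ} (hs : s ∈ Set.Ioo 0 (ω / 2)) : V s < 0 := by
  have h2 := P.dmu_pos hs
  have h3 := P.mu_pos s
  have h4 := P.xi_pos
  unfold climb; exact div_neg_of_neg_of_pos (by linarith) (by positivity)

theorem climb_zero : V 0 = 0 := by simp [climb, P.dmu_zero]

theorem climb_mid : V (ω / 2) = 0 := by simp [climb, P.dmu_mid]

theorem height_omega_sub (s : ℝ) : H (ω - s) = H s := by simp [height, P.mu_omega_sub]

theorem momentum_omega_sub (s : ℝ) : M (ω - s) = M s := by simp [momentum, P.mu_omega_sub]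

theorem climb_omega_sub (s : ℝ) : V (ω - s) = -V s := by
  simp [climb, P.mu_omega_sub, P.dmu_omega_sub, neg_div]

theorem height_add_int (s : ℝ) (j : ℤ) : H (s + j * ω) = H s := by simp [height, P.mu_add_int]

theorem momentum_add_int (s : ℝ) (j : ℤ) : M (s + j * ω) = M s := by
  simp [momentum, P.mu_add_int]

theorem dmu_add_int (s : ℝ) (j : ℤ) : dμ (s + j * ω) = dμ s :=
  (Function.Periodic.int_mul P.dmu_add_omega j) s

theorem climb_add_int (s : ℝ) (j : ℤ) : V (s + j * ω) = V s := by
  simp [climb, P.mu_add_int, P.dmu_add_int]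

theorem turn_omega_sub (s : ℝ) : B (ω - s) = -B s := by
  have hd : ∀ t, HasDerivAt (fun t => B (ω - t) + B t) 0 t := fun t => by
    have h1 := ((P.deriv_turn (ω - t)).comp_const_sub ω t).fun_add (P.deriv_turn t)
    rw [P.mu_omega_sub, P.momentum_omega_sub, P.height_omega_sub] at h1
    exact h1.congr_deriv (by ring)
  have := is_const_of_deriv_eq_zero (fun t => (hd t).differentiableAt) (fun t => (hd t).deriv)
    s (ω / 2)
  rw [show ω - ω / 2 = ω / 2 by ring, turn_mid] at this
  linarith

theorem turn_add_omega (s : ℝ) : B (s + ω) = B s + 2 * B ω := by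
  have hd : ∀ t, HasDerivAt (fun t => B (t + ω) - B t) 0 t := fun t => by
    have h1 := ((P.deriv_turn (t + ω)).comp_add_const t ω).fun_sub (P.deriv_turn t)
    have h2 := P.mu_add_int t 1
    have h3 := P.momentum_add_int t 1
    have h4 := P.height_add_int t 1
    simp only [Int.cast_one, one_mul] at h2 h3 h4
    rw [h2, h3, h4] at h1
    exact h1.congr_deriv (by ring)
  have h1 := is_const_of_deriv_eq_zero (fun t => (hd t).differentiableAt) (fun t => (hd t).deriv)
    s 0
  have h2 := P.turn_omega_sub 0
  simp only [sub_zero, zero_add] at h1 h2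
  linarith

theorem turn_add_int (s : ℝ) (j : ℤ) : B (s + j * ω) = B s + j * (2 * B ω) := by
  have hp : Function.Periodic (fun t => B t - t / ω * (2 * B ω)) ω := fun t => by
    have := P.omega_pos.ne'
    simp only [P.turn_add_omega]
    field_simp
    ring
  have := (hp.int_mul j) s
  have hω := P.omega_pos.ne'
  field_simp at this
  have h2 : ω * (B (s + j * ω) - (B s + j * (2 * B ω))) = 0 := by linear_combination this
  linarith [(mul_eq_zero.1 h2).resolve_left hω]

/-- The stereographic projection turns by an angle between `0` and `2π` over a period of the
curvature. -/
theorem turn_omega_mem : 0 < B ω ∧ B ω < π := by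
  have key := turning_bounds (a := 0) (b := ω / 2) (half_pos P.omega_pos)
    (h := H) (v := V) (m := M) (κ := fun s => μ s ^ 2) (β := fun s => B s - B 0)
    P.deriv_height P.deriv_climb P.deriv_momentum
    (fun s => (P.deriv_turn s).sub_const _) P.height_pos
    (fun s => pow_pos (P.mu_pos s) 2) P.unit (fun s hs => P.climb_neg hs) P.climb_zero P.climb_mid
    -- The curvature of the stereographic image is `μ² + (μ + λ)/ξ`, increasing in `μ > 0`, and `μ`
    -- increases on `[0, ω/2]`.
    (fun s hs t ht hst => by
      have h1 := P.strictMonoOn hs ht hst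
      have h2 := P.mu_pos s
      have h3 := P.xi_pos
      have e : ∀ s, μ s ^ 2 * (1 + H s) + M s = μ s ^ 2 + (2 * μ s + 2 * lam) / (2 * ξ) := by
        intro s
        have := (P.mu_pos s).ne'
        simp only [height, momentum]
        field_simp
        ring
      simp only [e]
      have h4 : μ s ^ 2 < μ t ^ 2 := pow_lt_pow_left₀ h1 h2.le (by norm_num)
      have h5 : (2 * μ s + 2 * lam) / (2 * ξ) < (2 * μ t + 2 * lam) / (2 * ξ) := by
        gcongr
      linarith) (by simp)
  -- By symmetry `B 0 = -B ω`, so the turn over the first half-period is `B ω`.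
  have h2 := P.turn_omega_sub 0
  simp only [sub_zero, turn_mid, zero_sub] at h2 key
  rwa [h2]

theorem planar_add_int (s : ℝ) (j : ℤ) : planar lam ξ ω μ dμ (s + j * ω) =
    Complex.exp ((j * (2 * B ω) : ℝ) * Complex.I) * planar lam ξ ω μ dμ s := by
  simp only [planar, P.momentum_add_int, P.climb_add_int, P.turn_add_int]
  have : ((B s + j * (2 * B ω) : ℝ) : ℂ) * Complex.I =
      ((j * (2 * B ω) : ℝ) : ℂ) * Complex.I + (B s : ℂ) * Complex.I := by
    push_cast; ring
  rw [this, Complex.exp_add]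
  ring

theorem planar_omega_sub (s : ℝ) : planar lam ξ ω μ dμ (ω - s) =
    (starRingEnd ℂ) (planar lam ξ ω μ dμ s) := by
  simp only [planar, P.momentum_omega_sub, P.climb_omega_sub, P.turn_omega_sub, map_mul, map_add,
    map_neg, Complex.conj_ofReal, Complex.conj_I, ← Complex.exp_conj]
  push_cast
  ring_nf

theorem norm_planar_sq (s : ℝ) : ‖planar lam ξ ω μ dμ s‖ ^ 2 = 1 - H s ^ 2 := by
  rw [planar, norm_mul, Complex.norm_exp_ofReal_mul_I, mul_one, ← Complex.normSq_eq_norm_sq,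
    ← Complex.ofReal_neg, Complex.normSq_add_mul_I]
  linarith [P.unit s, neg_sq (M s)]

/-- The first factor of the velocity has positive real part `h + m²/(1 + h)`, so only `e^{iB}`
contributes to the turning number. -/
theorem deriv_planar (s : ℝ) : HasDerivAt (planar lam ξ ω μ dμ)
    (((H s + M s ^ 2 / (1 + H s) : ℝ) - (M s * V s / (1 + H s) : ℝ) * Complex.I) * (-Complex.I) *
      Complex.exp (B s * Complex.I)) s := by
  have h1 := (((P.deriv_momentum s).ofReal_comp.neg).add
    ((P.deriv_climb s).ofReal_comp.mul_const Complex.I)).mul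
    (((P.deriv_turn s).ofReal_comp.mul_const Complex.I).cexp)
  refine h1.congr_deriv ?_
  have h2 : (1 + H s : ℂ) ≠ 0 := by exact_mod_cast (P.one_add_height_pos s).ne'
  simp only [Pi.add_apply, Pi.neg_apply]
  push_cast
  field_simp
  linear_combination ((μ s : ℂ) ^ 2 * (V s : ℂ) * (1 + (H s : ℂ))) * Complex.I_sq

end Profile
namespace Profile

variable {lam ξ e₁ e₂ ω : ℝ} {μ dμ : ℝ → ℝ} (P : Profile lam ξ e₁ e₂ ω μ dμ)
include P

local notation "H" => height ξ μ
local notation "V" => climb ξ μ dμ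
local notation "M" => momentum lam ξ μ
local notation "B" => turn lam ξ ω μ

open Filter Topology

/-! ### The angular function -/

theorem leastPeriod_mu : leastPeriod μ = ω := leastPeriod_eq P.omega_pos P.period_iff

theorem angular_mid : angular lam ξ μ (ω / 2) = 0 := by
  simp [angular, P.leastPeriod_mu]

theorem angular_omega_sub (s : ℝ) : angular lam ξ μ (ω - s) = -angular lam ξ μ s := by
  simp only [angular, P.leastPeriod_mu]
  have h := intervalIntegral.integral_comp_sub_left (a := s) (b := ω / 2)
    (fun t => μ t ^ 2 * (μ t + 2 * lam) / (1 - 4 * ξ ^ 2 * μ t ^ 2)) ω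
  simp only [P.mu_omega_sub] at h
  rw [show ω - ω / 2 = ω / 2 by ring] at h
  rw [← h, intervalIntegral.integral_symm]
  ring

theorem jump_eq : jump lam ξ μ = 2 * angular lam ξ μ ω := by
  have := P.angular_omega_sub 0
  rw [sub_zero] at this
  rw [jump, P.leastPeriod_mu]
  linarith

/-- The angular momentum `m` is the squared distance `1 - h²` from the axis times the polar angular
velocity; so `-θ` is the polar angle up to a constant. -/
theorem angular_integrand (s : ℝ) :
    2 * ξ * (μ s ^ 2 * (μ s + 2 * lam) / (1 - 4 * ξ ^ 2 * μ s ^ 2)) = -M s / (1 - H s ^ 2) := by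
  have h1 := (P.mu_pos s).ne'
  have h2 := P.xi_pos.ne'
  have h3 : 1 - H s ^ 2 = -(1 - 4 * ξ ^ 2 * μ s ^ 2) / (4 * ξ ^ 2 * μ s ^ 2) := by
    simp only [height]; field_simp; ring
  rw [h3]
  -- Where the denominator vanishes, both quotients are `0` by the convention for division.
  by_cases h0 : 1 - 4 * ξ ^ 2 * μ s ^ 2 = 0
  · simp [h0]
  · simp only [momentum]; field_simp; ring

theorem tendsto_arctan_atTop {l : Filter ℝ} {a : ℝ} (hl : l ≤ 𝓝 a) (hV : V a = 0)
    (hpos : ∀ᶠ s in l, 0 < V s) (hM : 0 < M a) :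
    Tendsto (fun s => Real.arctan (M s / V s)) l (𝓝 (π / 2)) := by
  have h1 : Tendsto V l (𝓝[>] 0) := tendsto_nhdsWithin_iff.2
    ⟨hV ▸ (P.continuous_climb.tendsto a).mono_left hl, hpos⟩
  have h2 : Tendsto (fun s => M s / V s) l atTop := by
    simp only [div_eq_mul_inv]
    exact ((P.continuous_momentum.tendsto a).mono_left hl).pos_mul_atTop hM
      (tendsto_inv_nhdsGT_zero.comp h1)
  exact (tendsto_nhdsWithin_iff.1 (Real.tendsto_arctan_atTop)).1.comp h2

theorem tendsto_arctan_atBot {l : Filter ℝ} {a : ℝ} (hl : l ≤ 𝓝 a) (hV : V a = 0)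
    (hpos : ∀ᶠ s in l, 0 < V s) (hM : M a < 0) :
    Tendsto (fun s => Real.arctan (M s / V s)) l (𝓝 (-(π / 2))) := by
  have h1 : Tendsto V l (𝓝[>] 0) := tendsto_nhdsWithin_iff.2
    ⟨hV ▸ (P.continuous_climb.tendsto a).mono_left hl, hpos⟩
  have h2 : Tendsto (fun s => M s / V s) l atBot := by
    simp only [div_eq_mul_inv]
    exact ((P.continuous_momentum.tendsto a).mono_left hl).neg_mul_atTop hM
      (tendsto_inv_nhdsGT_zero.comp h1)
  exact (tendsto_nhdsWithin_iff.1 (Real.tendsto_arctan_atBot)).1.comp h2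

theorem mu_omega : μ ω = e₂ := by
  have := P.mu_omega_sub 0
  rwa [sub_zero, P.mu_zero] at this

theorem climb_omega : V ω = 0 := by
  have := P.climb_omega_sub 0
  rwa [sub_zero, P.climb_zero, neg_zero] at this

/-- Comparison of `-ρ e^{-iθ}` with `(-m + iv) e^{iB}` shows that `θ + B` is the argument of `m +
iv`, so `θ + B + arctan (m/v)` is constant where `v > 0`. Its limit at `ω/2` is `π/2`; the limit of
the arctangent at `ω` depends on the sign of `e₂ + 2λ`. The continuous function `F` stands in for
the integrand, whose denominator vanishes at `ω` in the exceptional case. -/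
theorem angular_omega_add {F : ℝ → ℝ} (hF : Continuous F)
    (hFe : ∀ s ∈ Set.Ioo (ω / 2) ω,
      F s = μ s ^ 2 * (μ s + 2 * lam) / (1 - 4 * ξ ^ 2 * μ s ^ 2)) {L : ℝ}
    (hL : Tendsto (fun s => Real.arctan (M s / V s)) (𝓝[<] ω) (𝓝 L)) :
    angular lam ξ μ ω + B ω + L = π / 2 := by
  have hω : ω / 2 < ω := half_lt_self P.omega_pos
  have hA : ∀ s ∈ Set.Icc (ω / 2) ω, angular lam ξ μ s = 2 * ξ * ∫ t in (ω / 2)..s, F t := by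
    intro s hs
    rw [angular, P.leastPeriod_mu]
    congr 1
    refine intervalIntegral.integral_congr_ae ?_
    have : ∀ᵐ t ∂MeasureTheory.volume, t ≠ ω := by
      simp [MeasureTheory.ae_iff, MeasureTheory.measure_singleton]
    filter_upwards [this] with t ht1 ht
    rw [Set.uIoc_of_le hs.1] at ht
    exact (hFe t ⟨ht.1, lt_of_le_of_ne (ht.2.trans hs.2) ht1⟩).symm
  have dI : ∀ s, HasDerivAt (fun s => 2 * ξ * ∫ t in (ω / 2)..s, F t) (2 * ξ * F s) s := fun s =>
    (intervalIntegral.integral_hasDerivAt_right (hF.intervalIntegrable _ _)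
      hF.aestronglyMeasurable.stronglyMeasurableAtFilter hF.continuousAt).const_mul _
  let I : ℝ → ℝ := fun s => 2 * ξ * ∫ t in (ω / 2)..s, F t
  have cI : Continuous I := continuous_iff_continuousAt.2 fun s => (dI s).continuousAt
  let f : ℝ → ℝ := fun s => I s + B s + Real.arctan (M s / V s)
  have df : ∀ s ∈ Set.Ioo (ω / 2) ω, HasDerivAt f 0 s := by
    intro s hs
    have hV := P.climb_pos hs
    have h1 := ((dI s).add (P.deriv_turn s)).add
      (((P.deriv_momentum s).div (P.deriv_climb s) hV.ne').arctan)
    refine h1.congr_deriv ?_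
    have hu := P.unit s
    have hH := P.height_pos s
    have h1H := P.one_add_height_pos s
    have hlt : 0 < 1 - H s ^ 2 := by nlinarith [sq_nonneg (M s)]
    have hne : 1 - H s ≠ 0 := by
      intro h0
      rw [show H s = 1 by linarith] at hlt
      norm_num at hlt
    rw [hFe s hs, P.angular_integrand]
    simp only [Pi.div_apply]
    have e1 : 1 / (1 + (M s / V s) ^ 2) = V s ^ 2 / (1 - H s ^ 2) := by
      rw [show 1 - H s ^ 2 = V s ^ 2 + M s ^ 2 by linarith]
      field_simp
    rw [e1, show 1 - H s ^ 2 = (1 - H s) * (1 + H s) by ring]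
    have e2 : M s ^ 2 = 1 - H s ^ 2 - V s ^ 2 := by linarith
    field_simp
    ring_nf
    rw [e2]
    ring
  obtain ⟨r, hr⟩ := exists_between hω
  have hc : ∀ s ∈ Set.Ioo (ω / 2) ω, f s = f r := fun s hs =>
    isOpen_Ioo.is_const_of_deriv_eq_zero isPreconnected_Ioo
      (fun t ht => (df t ht).differentiableAt.differentiableWithinAt)
      (fun t ht => (df t ht).deriv) hs hr
  have l1 : 𝓝[>] (ω / 2) ≤ 𝓝 (ω / 2) := nhdsWithin_le_nhds
  have l2 : 𝓝[<] ω ≤ 𝓝 ω := nhdsWithin_le_nhds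
  have ev1 : ∀ᶠ s in 𝓝[>] (ω / 2), s ∈ Set.Ioo (ω / 2) ω := Ioo_mem_nhdsGT hω
  have ev2 : ∀ᶠ s in 𝓝[<] ω, s ∈ Set.Ioo (ω / 2) ω := Ioo_mem_nhdsLT hω
  have hMmid : 0 < M (ω / 2) := by
    have := P.top_pos
    have := P.xi_pos
    simp only [momentum, P.mid]; positivity
  have t1 : Tendsto f (𝓝[>] (ω / 2)) (𝓝 (I (ω / 2) + B (ω / 2) + π / 2)) :=
    (((cI.tendsto _).mono_left l1).add ((P.continuous_turn.tendsto _).mono_left l1)).add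
      (P.tendsto_arctan_atTop l1 P.climb_mid (ev1.mono fun s hs => P.climb_pos hs) hMmid)
  have t2 : Tendsto f (𝓝[<] ω) (𝓝 (I ω + B ω + L)) :=
    (((cI.tendsto _).mono_left l2).add ((P.continuous_turn.tendsto _).mono_left l2)).add hL
  have c1 := tendsto_nhds_unique (t1.congr' (ev1.mono hc)) tendsto_const_nhds
  have c2 := tendsto_nhds_unique (t2.congr' (ev2.mono hc)) tendsto_const_nhds
  rw [hA ω ⟨hω.le, le_rfl⟩]
  have e0 : I (ω / 2) = 0 := by simp [I]
  rw [e0, turn_mid] at c1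
  change I ω + B ω + L = π / 2
  linarith

/-! ### The jump in the three cases -/

/-- Height `1` forces `v = m = 0`, that is, `μ' = 0` and `μ = -2λ`. Then `μ` is `e₁` or `e₂`; the
first is excluded by `e₁ + 2λ > 0`, the second by `hne`. -/
theorem height_lt_one (hne : e₂ + 2 * lam ≠ 0) (s : ℝ) : H s < 1 := by
  have hu := P.unit s
  have hH := P.height_pos s
  by_contra! hcon
  have hV : V s = 0 := by
    have : V s ^ 2 = 0 := by nlinarith [sq_nonneg (M s), sq_nonneg (V s)]
    exact pow_eq_zero_iff (two_ne_zero) |>.1 this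
  have hM : M s = 0 := by
    have : M s ^ 2 = 0 := by nlinarith [sq_nonneg (M s), sq_nonneg (V s)]
    exact pow_eq_zero_iff (two_ne_zero) |>.1 this
  have h1 := (P.mu_pos s)
  have h2 := P.xi_pos
  have hd : dμ s = 0 := by
    have := div_eq_zero_iff.1 hV
    exact neg_eq_zero.1 (this.resolve_right (by positivity))
  have hm : μ s + 2 * lam = 0 := (div_eq_zero_iff.1 hM).resolve_right (by positivity)
  rcases (P.dmu_eq_zero_iff s).1 hd with e | e
  · rw [e] at hm; linarith [P.top_pos]
  · rw [e] at hm; exact hne hm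

theorem one_sub_height_sq_pos (hne : e₂ + 2 * lam ≠ 0) (s : ℝ) : 0 < 1 - H s ^ 2 := by
  nlinarith [P.height_lt_one hne s, P.height_pos s]

theorem continuous_angular_integrand (hne : e₂ + 2 * lam ≠ 0) :
    Continuous fun s => μ s ^ 2 * (μ s + 2 * lam) / (1 - 4 * ξ ^ 2 * μ s ^ 2) := by
  have c1 := P.continuous
  refine Continuous.div (by fun_prop) (by fun_prop) fun s hs => ?_
  have h1 := (P.mu_pos s).ne'
  have h2 := P.xi_pos.ne'
  have h3 : 1 - H s ^ 2 = -(1 - 4 * ξ ^ 2 * μ s ^ 2) / (4 * ξ ^ 2 * μ s ^ 2) := by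
    simp only [height]; field_simp; ring
  have := P.one_sub_height_sq_pos hne s
  rw [h3, hs] at this
  simp at this

theorem jump_of_pos (hpos : 0 < e₂ + 2 * lam) : jump lam ξ μ = -(2 * B ω) := by
  have hω : ω / 2 < ω := half_lt_self P.omega_pos
  have hM : 0 < M ω := by
    have := P.xi_pos
    simp only [momentum, P.mu_omega]; positivity
  have := P.angular_omega_add (P.continuous_angular_integrand hpos.ne') (fun _ _ => rfl)
    (P.tendsto_arctan_atTop nhdsWithin_le_nhds P.climb_omega
      (Filter.mem_of_superset (Ioo_mem_nhdsLT hω) fun s hs => P.climb_pos hs) hM)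
  rw [P.jump_eq]
  linarith

theorem jump_of_neg (hneg : e₂ + 2 * lam < 0) : jump lam ξ μ = 2 * π - 2 * B ω := by
  have hω : ω / 2 < ω := half_lt_self P.omega_pos
  have hM : M ω < 0 := by
    have := P.xi_pos
    simp only [momentum, P.mu_omega]; exact div_neg_of_neg_of_pos hneg (by positivity)
  have := P.angular_omega_add (P.continuous_angular_integrand hneg.ne) (fun _ _ => rfl)
    (P.tendsto_arctan_atBot nhdsWithin_le_nhds P.climb_omega
      (Filter.mem_of_superset (Ioo_mem_nhdsLT hω) fun s hs => P.climb_pos hs) hM)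
  rw [P.jump_eq]
  linarith

theorem mu_gt {s : ℝ} (hs : s ∈ Set.Ioo (ω / 2) ω) : e₂ < μ s := by
  refine lt_of_le_of_ne (P.mem_Icc s).1 fun e => ?_
  have h1 := P.climb_pos hs
  have := (P.dmu_eq_zero_iff s).2 (Or.inr e.symm)
  simp [climb, this] at h1

theorem jump_of_zero (h0 : e₂ + 2 * lam = 0) : jump lam ξ μ = π - 2 * B ω := by
  have hω : ω / 2 < ω := half_lt_self P.omega_pos
  have he2 := P.pos
  have hlam : lam < 0 := by linarith
  have hx : 4 * ξ ^ 2 * (4 * lam ^ 2) = 1 := by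
    have := (P.toRoots.lt_neg_two_mul_iff hlam).2.1 (by linarith)
    linarith
  have hξ := P.xi_pos
  have hmu : ∀ s, 0 < μ s - 2 * lam := fun s => by linarith [P.mu_pos s]
  have c1 := P.continuous
  -- Since `16ξ²λ² = 1`, the denominator `1 - 4ξ²μ²` contains the factor `μ + 2λ`; cancelling it
  -- gives this continuous extension.
  have hF : Continuous fun s => -(4 * lam ^ 2 * μ s ^ 2 / (μ s - 2 * lam)) :=
    (Continuous.div (by fun_prop) (by fun_prop) fun s => (hmu s).ne').neg
  have ev : ∀ᶠ s in 𝓝[<] ω, s ∈ Set.Ioo (ω / 2) ω := Ioo_mem_nhdsLT hω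
  -- At `ω` the ratio `m/v` is of the form `0/0`. The factor `μ + 2λ` enters `m²` twice but `v²`
  -- only once, so the ratio tends to `0`.
  have hsq : ∀ s ∈ Set.Ioo (ω / 2) ω, M s / V s = √(4 * lam ^ 2 * (μ s + 2 * lam) /
      ((μ s - 2 * lam) / μ s ^ 2 - 4 * lam ^ 2 * (μ s + 2 * lam))) := by
    intro s hs
    have h1 := P.mu_gt hs
    have h2 : 0 < μ s + 2 * lam := by linarith
    have h3 := P.climb_pos hs
    have h4 := P.mu_pos s
    have h5 : 0 < M s := by simp only [momentum]; positivity
    rw [← Real.sqrt_sq (div_pos h5 h3).le]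
    congr 1
    have eM : M s ^ 2 = 4 * lam ^ 2 * (μ s + 2 * lam) ^ 2 := by
      simp only [momentum, div_pow]
      rw [div_eq_iff (by positivity)]
      linear_combination (-(μ s + 2 * lam) ^ 2) * hx
    have eH : H s ^ 2 = 4 * lam ^ 2 / μ s ^ 2 := by
      simp only [height, div_pow]
      rw [div_eq_div_iff (by positivity) (by positivity)]
      linear_combination (-μ s ^ 2) * hx
    have eV : V s ^ 2 = (μ s + 2 * lam) *
        ((μ s - 2 * lam) / μ s ^ 2 - 4 * lam ^ 2 * (μ s + 2 * lam)) := by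
      have : V s ^ 2 = 1 - H s ^ 2 - M s ^ 2 := by linarith [P.unit s]
      rw [this, eM, eH]
      field_simp
      ring
    rw [div_pow, eM, eV, show 4 * lam ^ 2 * (μ s + 2 * lam) ^ 2 =
      (μ s + 2 * lam) * (4 * lam ^ 2 * (μ s + 2 * lam)) by ring, mul_div_mul_left _ _ h2.ne']
  have hL : Tendsto (fun s => Real.arctan (M s / V s)) (𝓝[<] ω) (𝓝 0) := by
    have hcont : ContinuousAt (fun s => Real.arctan √(4 * lam ^ 2 * (μ s + 2 * lam) /
        ((μ s - 2 * lam) / μ s ^ 2 - 4 * lam ^ 2 * (μ s + 2 * lam)))) ω := by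
      refine Real.continuous_arctan.continuousAt.comp (Real.continuous_sqrt.continuousAt.comp ?_)
      refine ContinuousAt.div (by fun_prop) ?_ ?_
      · have := (P.mu_pos ω).ne'
        fun_prop (disch := positivity)
      · have := hmu ω
        have h4 := P.mu_pos ω
        rw [P.mu_omega] at this h4 ⊢
        rw [h0, mul_zero, sub_zero]
        positivity
    have h1 : Tendsto _ (𝓝[<] ω) _ := hcont.tendsto.mono_left nhdsWithin_le_nhds
    rw [P.mu_omega, h0, mul_zero, zero_div, Real.sqrt_zero, Real.arctan_zero] at h1
    exact h1.congr' (ev.mono fun s hs => by simp only [hsq s hs])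
  have := P.angular_omega_add hF (fun s hs => ?_) hL
  · rw [P.jump_eq]
    linarith
  · have h1 := P.mu_gt hs
    have h2 : 0 < μ s + 2 * lam := by linarith
    have h3 := hmu s
    have e : 1 - 4 * ξ ^ 2 * μ s ^ 2 = -((μ s + 2 * lam) * (μ s - 2 * lam) / (4 * lam ^ 2)) := by
      rw [← neg_div, eq_div_iff (by have := hlam.ne; positivity)]
      linear_combination (-μ s ^ 2) * hx
    rw [e, div_neg, neg_inj, div_div_eq_mul_div, mul_comm (μ s + 2 * lam) (μ s - 2 * lam),
      ← mul_div_mul_right _ _ h2.ne']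
    ring_nf

/-! ### Polar coordinates -/

theorem deriv_angular (hne : e₂ + 2 * lam ≠ 0) (s : ℝ) :
    HasDerivAt (angular lam ξ μ) (-M s / (1 - H s ^ 2)) s := by
  have hF := P.continuous_angular_integrand hne
  rw [← P.angular_integrand]
  exact (intervalIntegral.integral_hasDerivAt_right (hF.intervalIntegrable _ _)
    hF.aestronglyMeasurable.stronglyMeasurableAtFilter hF.continuousAt).const_mul _

theorem planar_ne_zero (hne : e₂ + 2 * lam ≠ 0) (s : ℝ) : planar lam ξ ω μ dμ s ≠ 0 := by
  intro h
  have h1 := P.norm_planar_sq s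
  have h2 := P.one_sub_height_sq_pos hne s
  rw [h, norm_zero] at h1
  norm_num at h1
  linarith

theorem planar_polar (hne : e₂ + 2 * lam ≠ 0) (s : ℝ) : planar lam ξ ω μ dμ s =
    -(‖planar lam ξ ω μ dμ s‖ : ℂ) * Complex.exp ((-angular lam ξ μ s : ℝ) * Complex.I) := by
  let ρ : ℝ → ℝ := fun s => √(1 - H s ^ 2)
  have hρ : ∀ s, ‖planar lam ξ ω μ dμ s‖ = ρ s := fun s => by
    simp only [ρ]; rw [← P.norm_planar_sq, Real.sqrt_sq (norm_nonneg _)]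
  have hρ0 : ∀ s, 0 < ρ s := fun s => Real.sqrt_pos.2 (P.one_sub_height_sq_pos hne s)
  have hρsq : ∀ s, ρ s ^ 2 = 1 - H s ^ 2 := fun s =>
    Real.sq_sqrt (P.one_sub_height_sq_pos hne s).le
  have dρ : ∀ s, HasDerivAt ρ (-(H s * V s) / ρ s) s := fun s => by
    have := (((P.deriv_height s).pow 2).const_sub 1).sqrt (P.one_sub_height_sq_pos hne s).ne'
    refine this.congr_deriv ?_
    have h0 := (hρ0 s).ne'
    change _ / (2 * ρ s) = _
    push_cast
    field_simp
  -- This quotient is constant, and at `ω/2` it equals `-1`, because there `y + iz = -m` and the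
  -- distance to the axis is `m > 0`.
  let f : ℝ → ℂ := fun s => planar lam ξ ω μ dμ s *
    Complex.exp ((angular lam ξ μ s : ℝ) * Complex.I) / (ρ s : ℂ)
  have df : ∀ s, HasDerivAt f 0 s := by
    intro s
    have hne' : (ρ s : ℂ) ≠ 0 := by exact_mod_cast (hρ0 s).ne'
    have h1 := ((P.deriv_planar s).mul
      (((P.deriv_angular hne s).ofReal_comp.mul_const Complex.I).cexp)).div (dρ s).ofReal_comp hne'
    refine h1.congr_deriv ?_
    have h1H : (1 + H s : ℂ) ≠ 0 := by exact_mod_cast (P.one_add_height_pos s).ne'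
    have hsq : (ρ s : ℂ) ^ 2 = 1 - (H s : ℂ) ^ 2 := by exact_mod_cast hρsq s
    have hsq0 : (1 - (H s : ℂ) ^ 2) ≠ 0 := by rw [← hsq]; exact pow_ne_zero _ hne'
    have hu : (H s : ℂ) ^ 2 + (V s : ℂ) ^ 2 + (M s : ℂ) ^ 2 = 1 := by exact_mod_cast P.unit s
    simp only [Pi.mul_apply, planar]
    push_cast
    rw [div_eq_zero_iff]
    left
    set E := Complex.exp ((B s : ℂ) * Complex.I)
    set A := Complex.exp ((angular lam ξ μ s : ℂ) * Complex.I)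
    rw [← hsq]
    have hρρ : (ρ s : ℂ) * ρ s = (1 - H s) * (1 + H s) := by rw [← pow_two, hsq]; ring
    have h1H' : (1 - H s : ℂ) ≠ 0 := by
      intro h; apply hsq0; rw [show (1 - (H s : ℂ) ^ 2) = (1 - H s) * (1 + H s) by ring, h, zero_mul]
    field_simp
    have hI := Complex.I_sq
    have hM2 : (M s : ℂ) ^ 2 = 1 - (H s : ℂ) ^ 2 - (V s : ℂ) ^ 2 := by linear_combination hu
    ring_nf
    simp only [hI, hsq, hM2]
    ring
  have hc := is_const_of_deriv_eq_zero (fun t => (df t).differentiableAt) (fun t => (df t).deriv)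
    s (ω / 2)
  have hM : 0 < M (ω / 2) := by
    have := P.top_pos
    have := P.xi_pos
    simp only [momentum, P.mid]; positivity
  have hmid : f (ω / 2) = -1 := by
    have h1 : ρ (ω / 2) = M (ω / 2) := by
      have := P.unit (ω / 2)
      rw [P.climb_mid] at this
      simp only [ρ]
      rw [show 1 - H (ω / 2) ^ 2 = M (ω / 2) ^ 2 by linarith, Real.sqrt_sq hM.le]
    have h2 : (M (ω / 2) : ℂ) ≠ 0 := by exact_mod_cast hM.ne'
    simp only [f, planar, h1, P.angular_mid, turn_mid, P.climb_mid]
    simp [h2]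
  rw [hmid] at hc
  rw [hρ]
  have hne' : (ρ s : ℂ) ≠ 0 := by exact_mod_cast (hρ0 s).ne'
  have h3 : planar lam ξ ω μ dμ s * Complex.exp ((angular lam ξ μ s : ℝ) * Complex.I) = -(ρ s : ℂ) := by
    rw [div_eq_iff hne'] at hc
    rw [hc]; ring
  rw [← h3, mul_assoc, ← Complex.exp_add]
  push_cast
  simp

end Profile

/-! ### The Frenet frame of a spherical curve -/

theorem cross_zero (u w : E3) : cross u w 0 = u 1 * w 2 - u 2 * w 1 := by
  simp [cross, cross_apply]

theorem cross_one (u w : E3) : cross u w 1 = u 2 * w 0 - u 0 * w 2 := by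
  simp [cross, cross_apply]

theorem cross_two (u w : E3) : cross u w 2 = u 0 * w 1 - u 1 * w 0 := by
  simp [cross, cross_apply]

theorem inner_eq (u w : E3) : inner ℝ u w = u 0 * w 0 + u 1 * w 1 + u 2 * w 2 := by
  simp [PiLp.inner_apply, Fin.sum_univ_three, mul_comm]

theorem norm_eq_one_iff (u : E3) : ‖u‖ = 1 ↔ u 0 ^ 2 + u 1 ^ 2 + u 2 ^ 2 = 1 := by
  rw [← pow_eq_one_iff_of_nonneg (norm_nonneg u) two_ne_zero, EuclideanSpace.norm_sq_eq]
  simp [Fin.sum_univ_three]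

theorem hasDerivAt_coord {f : ℝ → E3} {f' : E3} {s : ℝ} (hf : HasDerivAt f f' s) (i : Fin 3) :
    HasDerivAt (fun s => f s i) (f' i) s :=
  (EuclideanSpace.proj (𝕜 := ℝ) i : E3 →L[ℝ] ℝ).hasFDerivAt.comp_hasDerivAt s hf

/-- The columns of an orthogonal matrix are orthonormal. -/
theorem columns_of_rows {p t n : E3} (pp : p 0 ^ 2 + p 1 ^ 2 + p 2 ^ 2 = 1)
    (tt : t 0 ^ 2 + t 1 ^ 2 + t 2 ^ 2 = 1) (pt : p 0 * t 0 + p 1 * t 1 + p 2 * t 2 = 0)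
    (hn : n = cross p t) (i j : Fin 3) :
    p i * p j + t i * t j + n i * n j = if i = j then 1 else 0 := by
  have n0 : n 0 = _ := hn ▸ cross_zero p t
  have n1 : n 1 = _ := hn ▸ cross_one p t
  have n2 : n 2 = _ := hn ▸ cross_two p t
  let A : Matrix (Fin 3) (Fin 3) ℝ := !![p 0, p 1, p 2; t 0, t 1, t 2; n 0, n 1, n 2]
  have h1 : A * A.transpose = 1 := by
    ext a b
    fin_cases a <;> fin_cases b <;>
      simp [A, Matrix.mul_apply, Fin.sum_univ_three] <;> try simp only [n0, n1, n2]
    all_goals first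
      | linear_combination pp | linear_combination tt | linear_combination pt
      | linear_combination tt + (t 0 ^ 2 + t 1 ^ 2 + t 2 ^ 2) * pp
          - (p 0 * t 0 + p 1 * t 1 + p 2 * t 2) * pt
      | ring
  have h2 : A.transpose * A = 1 := mul_eq_one_comm.1 h1
  have h3 := congrFun (congrFun h2 i) j
  rw [Matrix.one_apply] at h3
  rw [← h3]
  fin_cases i <;> fin_cases j <;> simp [A, Matrix.mul_apply, Fin.sum_univ_three]

theorem frame_relations {γ : ℝ → E3} (c : ContDiff ℝ 4 γ)
    (sph : ∀ s, γ s ∈ Metric.sphere (0 : E3) 1) (us : ∀ s, ‖deriv γ s‖ = 1) (s : ℝ) :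
    (γ s 0 ^ 2 + γ s 1 ^ 2 + γ s 2 ^ 2 = 1) ∧
    (deriv γ s 0 ^ 2 + deriv γ s 1 ^ 2 + deriv γ s 2 ^ 2 = 1) ∧
    (γ s 0 * deriv γ s 0 + γ s 1 * deriv γ s 1 + γ s 2 * deriv γ s 2 = 0) ∧
    (∀ i, HasDerivAt (fun s => γ s i) (deriv γ s i) s) ∧
    (∀ i, HasDerivAt (fun s => deriv γ s i)
      (-γ s i + curvature γ s * cross (γ s) (deriv γ s) i) s) ∧
    (∀ i, HasDerivAt (fun s => cross (γ s) (deriv γ s) i)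
      (-(curvature γ s * deriv γ s i)) s) := by
  have c3 : ContDiff ℝ 3 (deriv γ) := by
    have : ContDiff ℝ (3 + 1) γ := c
    exact (contDiff_succ_iff_deriv.1 this).2.2
  have d1 : ∀ s i, HasDerivAt (fun s => γ s i) (deriv γ s i) s := fun s =>
    hasDerivAt_coord (c.differentiable (by norm_num) s).hasDerivAt
  have d2 : ∀ s i, HasDerivAt (fun s => deriv γ s i) (deriv (deriv γ) s i) s := fun s =>
    hasDerivAt_coord (c3.differentiable (by norm_num) s).hasDerivAt
  have pp : ∀ s, γ s 0 ^ 2 + γ s 1 ^ 2 + γ s 2 ^ 2 = 1 := fun s =>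
    (norm_eq_one_iff _).1 (mem_sphere_zero_iff_norm.1 (sph s))
  have tt : ∀ s, deriv γ s 0 ^ 2 + deriv γ s 1 ^ 2 + deriv γ s 2 ^ 2 = 1 := fun s =>
    (norm_eq_one_iff _).1 (us s)
  have pt : ∀ s, γ s 0 * deriv γ s 0 + γ s 1 * deriv γ s 1 + γ s 2 * deriv γ s 2 = 0 := by
    intro s
    have h := (((d1 s 0).pow 2).add ((d1 s 1).pow 2)).add ((d1 s 2).pow 2)
    have h0 := h.unique ((hasDerivAt_const s (1 : ℝ)).congr_of_eventuallyEq
      (Filter.Eventually.of_forall pp))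
    push_cast at h0
    linear_combination h0 / 2
  have at0 : deriv (deriv γ) s 0 * deriv γ s 0 + deriv (deriv γ) s 1 * deriv γ s 1
      + deriv (deriv γ) s 2 * deriv γ s 2 = 0 := by
    have h := (((d2 s 0).pow 2).add ((d2 s 1).pow 2)).add ((d2 s 2).pow 2)
    have h0 := h.unique ((hasDerivAt_const s (1 : ℝ)).congr_of_eventuallyEq
      (Filter.Eventually.of_forall tt))
    push_cast at h0
    linear_combination h0 / 2
  have ap : deriv (deriv γ) s 0 * γ s 0 + deriv (deriv γ) s 1 * γ s 1
      + deriv (deriv γ) s 2 * γ s 2 = -1 := by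
    have h := (((d1 s 0).mul (d2 s 0)).add ((d1 s 1).mul (d2 s 1))).add ((d1 s 2).mul (d2 s 2))
    have h0 := h.unique ((hasDerivAt_const s (0 : ℝ)).congr_of_eventuallyEq
      (Filter.Eventually.of_forall pt))
    linear_combination h0 - tt s
  have col := columns_of_rows (pp s) (tt s) (pt s) rfl
  have an : curvature γ s = deriv (deriv γ) s 0 * cross (γ s) (deriv γ s) 0 +
      deriv (deriv γ) s 1 * cross (γ s) (deriv γ s) 1 +
      deriv (deriv γ) s 2 * cross (γ s) (deriv γ s) 2 := inner_eq _ _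
  -- In the orthonormal frame `γ, γ', γ × γ'` the acceleration has components `-1`, `0` and the
  -- curvature.
  have acc : ∀ i, deriv (deriv γ) s i =
      -γ s i + curvature γ s * cross (γ s) (deriv γ s) i := by
    intro i
    have h0 := col i 0
    have h1 := col i 1
    have h2 := col i 2
    have key : (if i = 0 then (1 : ℝ) else 0) * deriv (deriv γ) s 0 +
        (if i = 1 then (1 : ℝ) else 0) * deriv (deriv γ) s 1 +
        (if i = 2 then (1 : ℝ) else 0) * deriv (deriv γ) s 2 = deriv (deriv γ) s i := by
      fin_cases i <;> simp
    rw [← key, ← h0, ← h1, ← h2, an]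
    linear_combination γ s i * ap + deriv γ s i * at0
  refine ⟨pp s, tt s, pt s, d1 s, fun i => acc i ▸ d2 s i, fun i => ?_⟩
  have a0 := acc 0
  have a1 := acc 1
  have a2 := acc 2
  rw [cross_zero] at a0
  rw [cross_one] at a1
  rw [cross_two] at a2
  fin_cases i
  · have := ((d1 s 1).mul (d2 s 2)).sub ((d1 s 2).mul (d2 s 1))
    simp only [Fin.zero_eta, cross_zero]
    refine this.congr_deriv ?_
    rw [a1, a2]
    linear_combination curvature γ s * (γ s 0 * pt s - deriv γ s 0 * pp s)
  · have := ((d1 s 2).mul (d2 s 0)).sub ((d1 s 0).mul (d2 s 2))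
    simp only [Fin.mk_one, cross_one]
    refine this.congr_deriv ?_
    rw [a0, a2]
    linear_combination curvature γ s * (γ s 1 * pt s - deriv γ s 1 * pp s)
  · have := ((d1 s 0).mul (d2 s 1)).sub ((d1 s 1).mul (d2 s 0))
    simp only [Fin.reduceFinMk, cross_two]
    refine this.congr_deriv ?_
    rw [a0, a1]
    linear_combination curvature γ s * (γ s 2 * pt s - deriv γ s 2 * pp s)

/-- Class `C⁴` leaves `μ` the two derivatives needed for the second order equation. -/
theorem contDiff_curvature {γ : ℝ → E3} (c : ContDiff ℝ 4 γ) : ContDiff ℝ 2 (curvature γ) := by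
  have c3 : ContDiff ℝ 3 (deriv γ) := by
    have : ContDiff ℝ (3 + 1) γ := c
    exact (contDiff_succ_iff_deriv.1 this).2.2
  have c2 : ContDiff ℝ 2 (deriv (deriv γ)) := by
    have : ContDiff ℝ (2 + 1) (deriv γ) := c3
    exact (contDiff_succ_iff_deriv.1 this).2.2
  have k0 := contDiff_euclidean.1 (c.of_le (by norm_num : (2 : WithTop ℕ∞) ≤ 4))
  have k1 := contDiff_euclidean.1 (c3.of_le (by norm_num : (2 : WithTop ℕ∞) ≤ 3))
  have k2 := contDiff_euclidean.1 c2
  have : curvature γ = fun s =>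
      deriv (deriv γ) s 0 * (γ s 1 * deriv γ s 2 - γ s 2 * deriv γ s 1) +
      deriv (deriv γ) s 1 * (γ s 2 * deriv γ s 0 - γ s 0 * deriv γ s 2) +
      deriv (deriv γ) s 2 * (γ s 0 * deriv γ s 1 - γ s 1 * deriv γ s 0) := by
    ext s
    rw [curvature, inner_eq, cross_zero, cross_one, cross_two]
  rw [this]
  exact (((k2 0).mul (((k0 1).mul (k1 2)).sub ((k0 2).mul (k1 1)))).add
    ((k2 1).mul (((k0 2).mul (k1 0)).sub ((k0 0).mul (k1 2))))).add
    ((k2 2).mul (((k0 0).mul (k1 1)).sub ((k0 1).mul (k1 0))))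

theorem muInv_sq {lam ξ : ℝ} {γ : ℝ → E3} (hγ : IsBCurve lam ξ γ) (s : ℝ) :
    muInv γ s ^ 2 = curvature γ s := Real.sq_sqrt (hγ.convex s).le

theorem IsStandardBString.profile {lam e₁ : ℝ} {γ : ℝ → E3} (hγ : IsStandardBString lam e₁ γ) :
    Profile lam (xi lam e₁) e₁ (eTwo lam e₁) (leastPeriod (muInv γ)) (muInv γ)
      (deriv (muInv γ)) := by
  have hB := hγ.isStandard.isBCurve
  have hr := roots_eTwo hγ.parameters
  have hc : ContDiff ℝ 2 (muInv γ) :=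
    (contDiff_curvature hB.contDiff).sqrt fun s => (hB.convex s).ne'
  have pos : ∀ s, 0 < muInv γ s := fun s => Real.sqrt_pos.2 (hB.convex s)
  have hnc : ¬ ∀ s t, muInv γ s = muInv γ t := fun h =>
    hB.nonconstant ⟨muInv γ 0 ^ 2, fun s => by rw [← muInv_sq hB, h s 0]⟩
  obtain ⟨T, hT, hper⟩ := hB.periodic_curvature
  obtain ⟨p1, p2⟩ := periodic_iff_leastPeriod hc.continuous
    ⟨T, hT, fun s => by simp only [muInv, hper s]⟩ hnc
  exact
    { hr with
      omega_pos := p1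
      deriv_mu := fun s => (hc.differentiable (by norm_num) s).hasDerivAt
      deriv_dmu := deriv_deriv_eq_force hr hc pos hB.conservation hnc
      mu_pos := pos
      energy := hB.conservation
      period_iff := p2
      mid := hγ.isStandard.mu_init }

/-- The standard B-string in terms of its `μ`-invariant. -/
theorem IsStandardBString.coordinates {lam e₁ : ℝ} {γ : ℝ → E3}
    (hγ : IsStandardBString lam e₁ γ) (s : ℝ) :
    γ s 0 = height (xi lam e₁) (muInv γ) s ∧
    γ s 1 * deriv γ s 2 - γ s 2 * deriv γ s 1 = momentum lam (xi lam e₁) (muInv γ) s ∧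
    deriv γ s 0 = climb (xi lam e₁) (muInv γ) (deriv (muInv γ)) s ∧
    proj γ s = planar lam (xi lam e₁) (leastPeriod (muInv γ)) (muInv γ) (deriv (muInv γ)) s := by
  have P := hγ.profile
  have hB := hγ.isStandard.isBCurve
  set μ := muInv γ with hμ
  set ω := leastPeriod μ
  set ξ := xi lam e₁ with hξ
  set dμ := deriv μ
  have hκ : ∀ s, curvature γ s = μ s ^ 2 := fun s => (muInv_sq hB s).symm
  have fr := frame_relations hB.contDiff hB.mem_sphere hB.unit_speed
  simp only [hκ] at fr
  have he₁ : 0 < e₁ := P.pos.trans P.lt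
  set D := √(1 + (e₁ * (e₁ + 2 * lam)) ^ 2) with hD
  have hD0 : 0 < D := Real.sqrt_pos.2 (by positivity)
  have hξD : ξ = 1 / (2 * e₁) * D := rfl
  have p0 : γ (ω / 2) 0 = 1 / D := by rw [hγ.isStandard.pos_init]; rfl
  have p1 : γ (ω / 2) 1 = -(e₁ * (e₁ + 2 * lam)) / D := by rw [hγ.isStandard.pos_init]; rfl
  have p2 : γ (ω / 2) 2 = 0 := by rw [hγ.isStandard.pos_init]; rfl
  have t0 : deriv γ (ω / 2) 0 = 0 := by rw [hγ.isStandard.vel_init]; rfl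
  have t1 : deriv γ (ω / 2) 1 = 0 := by rw [hγ.isStandard.vel_init]; rfl
  have t2 : deriv γ (ω / 2) 2 = -1 := by rw [hγ.isStandard.vel_init]; rfl
  have row : ∀ s, γ s 0 = height ξ μ s ∧ deriv γ s 0 = climb ξ μ dμ s ∧
      cross (γ s) (deriv γ s) 0 = momentum lam ξ μ s := by
    intro s
    -- Both triples solve the Frenet system, which is skew-symmetric, so the squared distance
    -- between them is constant. It vanishes at `ω/2`.
    have hd : ∀ s, HasDerivAt (fun s => (γ s 0 - height ξ μ s) ^ 2 +
        (deriv γ s 0 - climb ξ μ dμ s) ^ 2 +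
        (cross (γ s) (deriv γ s) 0 - momentum lam ξ μ s) ^ 2) 0 s := by
      intro s
      obtain ⟨-, -, -, d1, d2, d3⟩ := fr s
      have := ((((d1 0).sub (P.deriv_height s)).pow 2).add
        (((d2 0).sub (P.deriv_climb s)).pow 2)).add (((d3 0).sub (P.deriv_momentum s)).pow 2)
      refine this.congr_deriv ?_
      simp only [Pi.sub_apply]
      push_cast
      ring
    have hc := is_const_of_deriv_eq_zero (fun t => (hd t).differentiableAt)
      (fun t => (hd t).deriv) s (ω / 2)
    have hmid : ω / 2 = leastPeriod (muInv γ) / 2 := rfl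
    have z1 : γ (ω / 2) 0 - height ξ μ (ω / 2) = 0 := by
      rw [p0, height, P.mid, hξD]; field_simp; ring
    have z2 : deriv γ (ω / 2) 0 - climb ξ μ dμ (ω / 2) = 0 := by
      rw [t0, P.climb_mid, sub_zero]
    have z3 : cross (γ (ω / 2)) (deriv γ (ω / 2)) 0 - momentum lam ξ μ (ω / 2) = 0 := by
      rw [cross_zero, p1, p2, t1, t2, momentum, P.mid, hξD]; field_simp; ring
    rw [z1, z2, z3] at hc
    norm_num at hc
    have a1 := sq_nonneg (γ s 0 - height ξ μ s)
    have a2 := sq_nonneg (deriv γ s 0 - climb ξ μ dμ s)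
    have a3 := sq_nonneg (cross (γ s) (deriv γ s) 0 - momentum lam ξ μ s)
    refine ⟨sub_eq_zero.1 (pow_eq_zero_iff two_ne_zero |>.1 (by linarith)),
      sub_eq_zero.1 (pow_eq_zero_iff two_ne_zero |>.1 (by linarith)),
      sub_eq_zero.1 (pow_eq_zero_iff two_ne_zero |>.1 (by linarith))⟩
  refine ⟨(row s).1, cross_zero (γ s) (deriv γ s) ▸ (row s).2.2, (row s).2.1, ?_⟩
  let w : ℝ → ℂ := fun s => (γ s 1 : ℂ) + (γ s 2 : ℂ) * Complex.I
  let τ : ℝ → ℂ := fun s => (deriv γ s 1 : ℂ) + (deriv γ s 2 : ℂ) * Complex.I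
  let ν : ℝ → ℂ := fun s => (cross (γ s) (deriv γ s) 1 : ℂ) +
    (cross (γ s) (deriv γ s) 2 : ℂ) * Complex.I
  have hw : ∀ s, proj γ s = w s := fun s => Complex.mk_eq_add_mul_I _ _
  have h1H : ∀ s, (1 + height ξ μ s : ℂ) ≠ 0 := fun s => by
    exact_mod_cast (P.one_add_height_pos s).ne'
  -- the identity `w = -(x' + i n) E`, multiplied by `1 + x`
  have hE : ∀ s, (1 + height ξ μ s : ℂ) * w s =
      -(climb ξ μ dμ s + momentum lam ξ μ s * Complex.I) * (τ s - Complex.I * ν s) := by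
    intro s
    obtain ⟨pp, tt, pt, -⟩ := fr s
    obtain ⟨r1, r2, r3⟩ := row s
    have c1 := columns_of_rows pp tt pt rfl 0 1
    have c2 := columns_of_rows pp tt pt rfl 0 2
    rw [if_neg (by decide), r1, r2, r3] at c1 c2
    have q1 : climb ξ μ dμ s * cross (γ s) (deriv γ s) 1 -
        momentum lam ξ μ s * deriv γ s 1 = γ s 2 := by
      rw [← r2, ← r3, cross_zero, cross_one]
      linear_combination γ s 2 * tt - deriv γ s 2 * pt
    have q2 : momentum lam ξ μ s * deriv γ s 2 -
        climb ξ μ dμ s * cross (γ s) (deriv γ s) 2 = γ s 1 := by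
      rw [← r2, ← r3, cross_zero, cross_two]
      linear_combination γ s 1 * tt - deriv γ s 1 * pt
    simp only [w, τ, ν]
    apply Complex.ext
    · simp
      linear_combination c1 - q2
    · simp
      linear_combination c2 - q1
  let E : ℝ → ℂ := fun s => (τ s - Complex.I * ν s) / (1 + height ξ μ s)
  have hwE : ∀ s, w s = -(climb ξ μ dμ s + momentum lam ξ μ s * Complex.I) * E s := by
    intro s
    simp only [E]
    rw [mul_div_assoc', ← hE, mul_div_cancel_left₀ _ (h1H s)]
  -- `E` obeys a pure rotation equation with angular speed `B'`, and `E(ω/2) = -i`; hence `E = -i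
  -- e^{iB}`.
  have dE : ∀ s, HasDerivAt E
      (Complex.I * (μ s ^ 2 + momentum lam ξ μ s / (1 + height ξ μ s)) * E s) s := by
    intro s
    obtain ⟨-, -, -, d1, d2, d3⟩ := fr s
    have hτ := (d2 1).ofReal_comp.add ((d2 2).ofReal_comp.mul_const Complex.I)
    have hν := (d3 1).ofReal_comp.add ((d3 2).ofReal_comp.mul_const Complex.I)
    have := (hτ.sub (hν.const_mul Complex.I)).div ((P.deriv_height s).ofReal_comp.const_add 1)
      (h1H s)
    refine this.congr_deriv ?_
    have e1 : τ s - Complex.I * ν s = (1 + height ξ μ s) * E s := by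
      simp only [E]; rw [mul_div_cancel₀ _ (h1H s)]
    have e2 := hwE s
    rw [div_eq_iff (pow_ne_zero 2 (h1H s))]
    simp only [Pi.sub_apply, Pi.add_apply]
    simp only [w, τ, ν] at e1 e2
    have h0 := h1H s
    rw [e1]
    obtain ⟨q, hq⟩ : ∃ q : ℂ, q = momentum lam ξ μ s / (1 + height ξ μ s) := ⟨_, rfl⟩
    have hM : (momentum lam ξ μ s : ℂ) = q * (1 + height ξ μ s) := by rw [hq, div_mul_cancel₀ _ h0]
    rw [← hq]
    rw [hM] at e2
    generalize E s = x at *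
    push_cast
    linear_combination (-(1 + (height ξ μ s : ℂ))) * e2 + (μ s : ℂ) ^ 2 * Complex.I *
      (1 + (height ξ μ s : ℂ)) * e1 + (μ s : ℂ) ^ 2 * (1 + (height ξ μ s : ℂ)) *
      ((cross (γ s) (deriv γ s) 1 : ℂ) + (cross (γ s) (deriv γ s) 2 : ℂ) * Complex.I) * Complex.I_sq
  let G : ℝ → ℂ := fun s => E s * Complex.exp (-(turn lam ξ ω μ s : ℂ) * Complex.I)
  have dG : ∀ s, HasDerivAt G 0 s := by
    intro s
    refine ((dE s).mul (((P.deriv_turn s).ofReal_comp.neg.mul_const Complex.I).cexp)).congr_deriv ?_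
    simp only [Pi.neg_apply]
    push_cast
    ring
  have hc := is_const_of_deriv_eq_zero (fun t => (dG t).differentiableAt)
    (fun t => (dG t).deriv) s (ω / 2)
  have hmid : G (ω / 2) = -Complex.I := by
    simp only [G, E, Profile.turn_mid, τ, ν, cross_one, cross_two, p0, p1, p2, t0, t1, t2, ← (row _).1]
    have : (D : ℂ) ≠ 0 := by exact_mod_cast hD0.ne'
    have h2 : (1 + D : ℂ) ≠ 0 := by
      have : 0 < 1 + D := by positivity
      exact_mod_cast this.ne'
    have h3 : (D + 1 : ℂ) ≠ 0 := by rwa [add_comm]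
    push_cast
    simp
    field_simp
    ring
  rw [hmid] at hc
  have hEs : E s = -Complex.I * Complex.exp (turn lam ξ ω μ s * Complex.I) := by
    rw [← hc]
    simp only [G]
    rw [mul_assoc, ← Complex.exp_add]
    simp
  rw [hw, hwE, hEs, planar]
  linear_combination (momentum lam ξ μ s * Complex.exp (turn lam ξ ω μ s * Complex.I)) *
    Complex.I_sq


/-! ### Closed curves with a rotational symmetry -/

theorem ext_proj {u w : E3} (h0 : u 0 = w 0) (h : (⟨u 1, u 2⟩ : ℂ) = ⟨w 1, w 2⟩) : u = w := by
  obtain ⟨h1, h2⟩ := Complex.mk.inj h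
  ext i
  fin_cases i <;> assumption

theorem proj_rotOx (α : ℝ) (u : E3) : (⟨rotOx α u 1, rotOx α u 2⟩ : ℂ) =
    Complex.exp (α * Complex.I) * ⟨u 1, u 2⟩ := by
  apply Complex.ext <;>
    simp [rotOx, Complex.exp_ofReal_mul_I_re, Complex.exp_ofReal_mul_I_im, -Complex.ofReal_cos,
      -Complex.ofReal_sin]
  ring

/-- A curve on the unit sphere that is symmetric with respect to meridian half-planes and invariant
under `s ↦ s + ω`, up to a rotation by `2π (n - m) / n` about the `Ox`-axis, and whose height is
injective modulo these symmetries. -/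
structure RotationalCurve (γ : ℝ → E3) (ω : ℝ) (m n : ℕ) : Prop where
  omega_pos : 0 < ω
  pos : 0 < m
  lt : m < n
  coprime : Nat.Coprime m n
  height_eq_iff : ∀ s t, γ s 0 = γ t 0 ↔ ∃ j : ℤ, t = s + j * ω ∨ t = -s + j * ω
  height_periodic_iff : ∀ T, Function.Periodic (fun s => γ s 0) T ↔ ∃ j : ℤ, T = j * ω
  proj_add_int : ∀ s, ∀ j : ℤ, proj γ (s + j * ω) =
    Complex.exp ((j * (2 * π * ((n - m) / n)) : ℝ) * Complex.I) * proj γ s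
  proj_omega_sub : ∀ s, proj γ (ω - s) = (starRingEnd ℂ) (proj γ s)
  proj_mid : proj γ (ω / 2) ≠ 0
  height_pos : ∀ s, 0 < γ s 0
  sphere : ∀ s, γ s 0 ^ 2 + ‖proj γ s‖ ^ 2 = 1

/-- `n - m` is invertible modulo `n`, so every rotation by a multiple of `2π/n` is a power of the
rotation acquired over one period of `μ`. -/
theorem exists_bezout {m n : ℕ} (hmn : m.Coprime n) (k : ℤ) :
    ∃ j l : ℤ, j * (n - m) = k + n * l := by
  have h : IsCoprime ((n : ℤ) - m) (n : ℤ) := by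
    have h1 : IsCoprime (m : ℤ) (n : ℤ) := Nat.isCoprime_iff_coprime.2 hmn
    have h2 := h1.neg_left.add_mul_right_left 1
    rwa [one_mul, neg_add_eq_sub] at h2
  obtain ⟨a, b, hab⟩ := h
  exact ⟨k * a, -(k * b), by linear_combination k * hab⟩

theorem exp_eq_one_iff_dvd {m n : ℕ} (hn : 0 < n) (hmn : m.Coprime n) (j : ℤ) :
    Complex.exp ((j * (2 * π * ((n - m) / n)) : ℝ) * Complex.I) = 1 ↔ (n : ℤ) ∣ j := by
  have hn' : (n : ℝ) ≠ 0 := by exact_mod_cast hn.ne'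
  have hπ := Real.pi_ne_zero
  rw [Complex.exp_eq_one_iff]
  constructor
  · rintro ⟨k, hk⟩
    have h1 : ((j * (2 * π * ((n - m) / n)) : ℝ) : ℂ) = ((k * (2 * π) : ℝ) : ℂ) := by
      apply mul_right_cancel₀ Complex.I_ne_zero
      rw [hk]; push_cast; ring
    have h2 : j * (2 * π * ((n - m) / n)) = k * (2 * π) := Complex.ofReal_injective h1
    field_simp at h2
    have h3 : j * ((n : ℤ) - m) = n * k := by exact_mod_cast h2
    have h4 : (n : ℤ) ∣ j * m := ⟨j - k, by linear_combination -h3⟩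
    exact (Nat.isCoprime_iff_coprime.2 hmn.symm).dvd_of_dvd_mul_right h4
  · rintro ⟨k, rfl⟩
    refine ⟨k * (n - m), ?_⟩
    have hn'' : (n : ℂ) ≠ 0 := by exact_mod_cast hn.ne'
    push_cast
    field_simp

namespace RotationalCurve

variable {γ : ℝ → E3} {ω : ℝ} {m n : ℕ} (R : RotationalCurve γ ω m n)
include R

theorem n_pos : 0 < n := R.pos.trans R.lt

theorem cast_n_pos : (0 : ℝ) < n := by exact_mod_cast R.n_pos

theorem height_add_int (s : ℝ) (j : ℤ) : γ (s + j * ω) 0 = γ s 0 :=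
  (R.height_periodic_iff _).2 ⟨j, rfl⟩ s

theorem add_int (s : ℝ) (j : ℤ) : γ (s + j * ω) = rotOx (j * (2 * π * ((n - m) / n))) (γ s) :=
  ext_proj (R.height_add_int s j) (by rw [proj_rotOx]; exact R.proj_add_int s j)

theorem add_int_congr {s t : ℝ} (h : γ s = γ t) (j : ℤ) : γ (s + j * ω) = γ (t + j * ω) := by
  rw [R.add_int, R.add_int, h]

theorem periodic_dvd {j : ℤ} (hj : (n : ℤ) ∣ j) (s : ℝ) : γ (s + j * ω) = γ s :=
  ext_proj (R.height_add_int s j) (by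
    have := R.proj_add_int s j
    rwa [(exp_eq_one_iff_dvd R.n_pos R.coprime j).2 hj, one_mul] at this)

theorem dvd_of_proj_eq {s : ℝ} (h0 : proj γ s ≠ 0) {j : ℤ} (h : proj γ (s + j * ω) = proj γ s) :
    (n : ℤ) ∣ j := by
  rw [R.proj_add_int] at h
  exact (exp_eq_one_iff_dvd R.n_pos R.coprime j).1 (mul_eq_right₀ h0 |>.1 h)

/-- A period of `γ` is one of its height, hence some `jω`. The corresponding rotation fixes the
point at `ω/2`, which is off the axis, so `n` divides `j`. -/
theorem period_iff (T : ℝ) : Function.Periodic γ T ↔ ∃ k : ℤ, T = k * (n * ω) := by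
  constructor
  · intro h
    obtain ⟨j, rfl⟩ := (R.height_periodic_iff T).1 fun s => by simp only [h s]
    have h1 : proj γ (ω / 2 + j * ω) = proj γ (ω / 2) := by simp only [proj, h (ω / 2)]
    obtain ⟨k, rfl⟩ := R.dvd_of_proj_eq R.proj_mid h1
    exact ⟨k, by push_cast; ring⟩
  · rintro ⟨k, rfl⟩ s
    have := R.periodic_dvd (dvd_mul_right (n : ℤ) k) s
    push_cast at this
    rw [← this]
    ring_nf

/-- On the sphere a point of positive height is determined by its projection. -/
theorem proj_period_iff (T : ℝ) : Function.Periodic (proj γ) T ↔ ∃ k : ℤ, T = k * (n * ω) := by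
  rw [← R.period_iff]
  constructor
  · intro h s
    have h1 := R.sphere s
    have h2 := R.sphere (s + T)
    rw [h s] at h2
    refine ext_proj ?_ (h s)
    have h3 := R.height_pos s
    have h4 := R.height_pos (s + T)
    exact (pow_left_inj₀ h4.le h3.le two_ne_zero).1 (by linarith)
  · intro h s
    simp only [proj, h s]

theorem leastPeriod_eq : leastPeriod γ = n * ω :=
  BCurves.leastPeriod_eq (mul_pos R.cast_n_pos R.omega_pos) R.period_iff

theorem leastPeriod_proj_eq : leastPeriod (proj γ) = n * ω :=
  BCurves.leastPeriod_eq (mul_pos R.cast_n_pos R.omega_pos) R.proj_period_iff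

theorem image_rotOx (k : ℤ) : rotOx (k * (2 * π / n)) '' Set.range γ = Set.range γ := by
  obtain ⟨j, l, hjl⟩ := exists_bezout R.coprime k
  have hn := R.cast_n_pos.ne'
  have key : ∀ s, rotOx (k * (2 * π / n)) (γ s) = γ (s + j * ω) := by
    intro s
    rw [R.add_int]
    refine ext_proj rfl ?_
    rw [proj_rotOx, proj_rotOx]
    congr 1
    rw [Complex.exp_eq_exp_iff_exists_int]
    refine ⟨-l, ?_⟩
    have h1 : (j : ℝ) * (n - m) = k + n * l := by exact_mod_cast hjl
    have h2 : k * (2 * π / n) = j * (2 * π * ((n - m) / n)) + (-l : ℤ) * (2 * π) := by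
      push_cast
      field_simp
      linear_combination -h1
    rw [h2]
    push_cast
    ring
  ext p
  constructor
  · rintro ⟨_, ⟨s, rfl⟩, rfl⟩
    exact ⟨s + j * ω, (key s).symm⟩
  · rintro ⟨s, rfl⟩
    exact ⟨γ (s - j * ω), ⟨_, rfl⟩, by rw [key]; ring_nf⟩

theorem eq_of_dvd {s t : ℝ} (hs : s ∈ Set.Ico 0 (n * ω)) (ht : t ∈ Set.Ico 0 (n * ω)) {j : ℤ}
    (hj : (n : ℤ) ∣ j) (h : t = s + j * ω) : t = s := by
  obtain ⟨k, rfl⟩ := hj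
  have hp : 0 < n * ω := mul_pos R.cast_n_pos R.omega_pos
  push_cast at h
  have h1 : t = s + k * (n * ω) := by rw [h]; ring
  have hk : k = 0 := by
    have a1 : (-1 : ℝ) < k := by
      by_contra! hcon
      nlinarith [hs.2, ht.1]
    have a2 : (k : ℝ) < 1 := by
      by_contra! hcon
      nlinarith [hs.1, ht.2]
    have a1' : (-1 : ℤ) < k := by exact_mod_cast a1
    have a2' : k < (1 : ℤ) := by exact_mod_cast a2
    omega
  rw [h1, hk]
  simp

theorem exists_reduce (t : ℝ) : ∃ k : ℤ, (n : ℤ) ∣ k ∧ t + k * ω ∈ Set.Ico 0 (n * ω) ∧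
    γ (t + k * ω) = γ t := by
  have hp : 0 < n * ω := mul_pos R.cast_n_pos R.omega_pos
  have hd : (n : ℤ) ∣ n * -⌊t / (n * ω)⌋ := dvd_mul_right _ _
  refine ⟨_, hd, ?_, R.periodic_dvd hd t⟩
  have h1 := Int.floor_le (t / (n * ω))
  have h2 := Int.lt_floor_add_one (t / (n * ω))
  rw [le_div_iff₀ hp] at h1
  rw [div_lt_iff₀ hp] at h2
  push_cast
  constructor <;> linarith

/-- Equal heights leave a translation or a reflection of the parameter. A translation would be a
rotation fixing a point off the axis, hence trivial, and the parameters would coincide. -/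
theorem sum_of_eq {s t : ℝ} (h0 : proj γ s ≠ 0) (hs : s ∈ Set.Ico 0 (n * ω))
    (ht : t ∈ Set.Ico 0 (n * ω)) (hst : s ≠ t) (h : γ s = γ t) : ∃ j : ℤ, t = -s + j * ω := by
  obtain ⟨j, hj | hj⟩ := (R.height_eq_iff s t).1 (by rw [h])
  · have := R.dvd_of_proj_eq h0 (j := j) (by rw [← hj]; simp only [proj, h])
    exact absurd (R.eq_of_dvd hs ht this hj).symm hst
  · exact ⟨j, hj⟩

/-- A point off the axis is passed at most twice. -/
theorem passages_eq {s t : ℝ} (h0 : proj γ s ≠ 0) (hs : s ∈ Set.Ico 0 (n * ω))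
    (ht : t ∈ Set.Ico 0 (n * ω)) (hst : s ≠ t) (h : γ s = γ t) : passages γ (γ s) = {s, t} := by
  ext u
  simp only [passages, R.leastPeriod_eq, Set.mem_ofPred_eq, Set.mem_insert_iff,
    Set.mem_singleton_iff]
  constructor
  · rintro ⟨hu, hus⟩
    by_contra! hcon
    obtain ⟨i, hi⟩ := R.sum_of_eq h0 hs hu hcon.1.symm hus.symm
    obtain ⟨j, hj⟩ := R.sum_of_eq h0 hs ht hst h
    have h1 : u = t + ((i - j : ℤ) : ℝ) * ω := by rw [hi, hj]; push_cast; ring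
    have h2 : proj γ t ≠ 0 := by
      have : proj γ t = proj γ s := by simp only [proj, h]
      rwa [this]
    have h3 := R.dvd_of_proj_eq h2 (j := i - j) (by rw [← h1]; simp only [proj, hus, h])
    exact hcon.2 (R.eq_of_dvd ht hu h3 h1)
  · rintro (rfl | rfl)
    · exact ⟨hs, rfl⟩
    · exact ⟨ht, h.symm⟩

theorem mem_selfIntersections_iff (p : E3) : p ∈ selfIntersections γ ↔
    ∃ s t, s ∈ Set.Ico 0 (n * ω) ∧ t ∈ Set.Ico 0 (n * ω) ∧ s ≠ t ∧ γ s = p ∧ γ t = p := by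
  have : p ∈ selfIntersections γ ↔ 1 < (passages γ p).encard := by
    rw [selfIntersections, Set.mem_ofPred_eq, ← one_add_one_eq_two,
      ENat.add_one_le_iff (by simp)]
  rw [this, Set.one_lt_encard_iff]
  simp only [passages, R.leastPeriod_eq, Set.mem_ofPred_eq]
  constructor
  · rintro ⟨s, t, ⟨h1, h2⟩, ⟨h3, h4⟩, h5⟩
    exact ⟨s, t, h1, h3, h5, h2, h4⟩
  · rintro ⟨s, t, h1, h3, h5, h2, h4⟩
    exact ⟨s, t, ⟨h1, h2⟩, ⟨h3, h4⟩, h5⟩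

theorem not_two_mul {r : ℝ} (hr : r ∈ Set.Ioo 0 (ω / 2)) (j : ℤ) : 2 * r ≠ j * ω := by
  intro h
  have hω := R.omega_pos
  have h1 : (0 : ℝ) < j := by
    by_contra! hcon
    nlinarith [hr.1]
  have h2 : (j : ℝ) < 1 := by
    by_contra! hcon
    nlinarith [hr.2]
  have h1' : 0 < j := by exact_mod_cast h1
  have h2' : j < 1 := by exact_mod_cast h2
  omega

/-! ### Self-intersections in terms of the polar angle -/

section Polar

variable {φ : ℝ → ℝ} (h0 : ∀ s, proj γ s ≠ 0)
  (polar : ∀ s, proj γ s = -(‖proj γ s‖ : ℂ) * Complex.exp (φ s * Complex.I))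
include h0 polar

/-- The curve meets its mirror image at `s` if and only if twice the polar angle is a multiple of
the rotation angle, modulo `2π`. -/
theorem fold_iff (s : ℝ) (j : ℤ) : γ (-s + j * ω) = γ s ↔
    ∃ k : ℤ, 2 * φ s = (j - 1) * (2 * π * ((n - m) / n)) + k * (2 * π) := by
  have h1 : γ (-s + j * ω) 0 = γ s 0 := ((R.height_eq_iff _ _).2 ⟨j, Or.inr (by ring)⟩)
  -- Since `-s + jω = (ω - s) + (j - 1)ω`, conjugation is followed by only `j - 1` rotations.
  have h2 : proj γ (-s + j * ω) =
      Complex.exp (((j - 1) * (2 * π * ((n - m) / n)) : ℝ) * Complex.I) *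
        (starRingEnd ℂ) (proj γ s) := by
    have := R.proj_add_int (ω - s) (j - 1)
    rw [R.proj_omega_sub] at this
    push_cast at this ⊢
    rw [← this]
    ring_nf
  have h3 : (starRingEnd ℂ) (proj γ s) =
      -(‖proj γ s‖ : ℂ) * Complex.exp (-φ s * Complex.I) := by
    conv_lhs => rw [polar s]
    rw [map_mul, map_neg, Complex.conj_ofReal, ← Complex.exp_conj, map_mul, Complex.conj_ofReal,
      Complex.conj_I]
    ring_nf
  have hn : -(‖proj γ s‖ : ℂ) ≠ 0 := by
    rw [neg_ne_zero]; exact_mod_cast norm_ne_zero_iff.2 (h0 s)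
  have h4 : γ (-s + j * ω) = γ s ↔ proj γ (-s + j * ω) = proj γ s :=
    ⟨fun h => by simp only [proj, h], fun h => ext_proj h1 h⟩
  rw [h4, h2, h3]
  conv_lhs => rhs; rw [polar s]
  rw [mul_left_comm, mul_right_inj' hn, ← Complex.exp_add, Complex.exp_eq_exp_iff_exists_int]
  constructor
  · rintro ⟨k, hk⟩
    refine ⟨-k, ?_⟩
    have h5 : (((j - 1) * (2 * π * ((n - m) / n)) - φ s : ℝ) : ℂ) = ((φ s + k * (2 * π) : ℝ) : ℂ) := by
      apply mul_right_cancel₀ Complex.I_ne_zero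
      push_cast at hk ⊢
      linear_combination hk
    have h6 := Complex.ofReal_injective h5
    push_cast
    linarith
  · rintro ⟨k, hk⟩
    refine ⟨-k, ?_⟩
    have h5 : (((j - 1) * (2 * π * ((n - m) / n)) - φ s : ℝ) : ℂ) =
        ((φ s + (-k) * (2 * π) : ℝ) : ℂ) := by
      congr 1; linarith
    push_cast at h5 ⊢
    linear_combination Complex.I * h5

/-- Twice the angle `πi/n` is a multiple of `2π/n`, which modulo `2π` is a multiple of the period
rotation; so some reflected parameter reaches the same point. -/
theorem mem_selfIntersections {r : ℝ} (hr : r ∈ Set.Ioo 0 (ω / 2)) {i : ℤ}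
    (hi : φ r = π * i / n) (q : ℤ) : γ (r + q * ω) ∈ selfIntersections γ := by
  obtain ⟨j, l, hjl⟩ := exists_bezout R.coprime i
  have hn := R.cast_n_pos.ne'
  have h1 : γ (-r + (j + 1 : ℤ) * ω) = γ r := by
    refine (R.fold_iff h0 polar r (j + 1)).2 ⟨-l, ?_⟩
    have h1 : (j : ℝ) * (n - m) = i + n * l := by exact_mod_cast hjl
    rw [hi]
    push_cast
    field_simp
    linear_combination -h1
  have h2 := R.add_int_congr h1 q
  obtain ⟨k₁, -, hs, hs'⟩ := R.exists_reduce (r + q * ω)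
  obtain ⟨k₂, -, ht, ht'⟩ := R.exists_reduce (-r + (j + 1 : ℤ) * ω + q * ω)
  refine (R.mem_selfIntersections_iff _).2 ⟨_, _, hs, ht, fun e => ?_, hs', ht'.trans h2⟩
  -- Were the two reduced parameters equal, `2r` would be a multiple of `ω`.
  refine R.not_two_mul hr (j + 1 + k₂ - k₁) ?_
  push_cast at e ⊢
  linear_combination e

/-- Every self-intersection is a crossing of a descending and an ascending arc. -/
theorem exists_of_mem_selfIntersections
    (add : ∀ s, ∀ j : ℤ, φ (s + j * ω) = φ s + j * (2 * π * ((n - m) / n)))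
    {p : E3} (hp : p ∈ selfIntersections γ) :
    ∃ r ∈ Set.Ioo 0 (ω / 2), ∃ q : ℕ, q < n ∧ (∃ i : ℤ, φ r = π * i / n) ∧
      γ (r + q * ω) = p := by
  obtain ⟨s, t, hs, ht, hst, rfl, hts⟩ := (R.mem_selfIntersections_iff p).1 hp
  have hω := R.omega_pos
  obtain ⟨j, hj⟩ := R.sum_of_eq (h0 s) hs ht hst hts.symm
  -- neither of the two parameters is a multiple of `ω / 2`
  have hne : ∀ i : ℤ, 2 * s ≠ i * ω := fun i hi => by
    have h1 : t = s + ((j - i : ℤ) : ℝ) * ω := by rw [hj]; push_cast; linarith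
    have h2 := R.dvd_of_proj_eq (h0 s) (j := j - i) (by rw [← h1]; simp only [proj, hts])
    exact hst (R.eq_of_dvd hs ht h2 h1).symm
  have main : ∀ u ∈ Set.Ico 0 (n * ω), γ u = γ s → (∃ j : ℤ, γ (-u + j * ω) = γ u) →
      ∀ r ∈ Set.Ioo 0 (ω / 2), ∀ q : ℤ, u = r + q * ω →
      ∃ r ∈ Set.Ioo 0 (ω / 2), ∃ q : ℕ, q < n ∧ (∃ i : ℤ, φ r = π * i / n) ∧
        γ (r + q * ω) = γ s := by
    rintro u hu hus ⟨j, hj⟩ r hr q rfl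
    have q0 : 0 ≤ q := by
      have : (-1 : ℝ) < q := by
        by_contra! hcon
        nlinarith [hu.1, hr.2]
      have : (-1 : ℤ) < q := by exact_mod_cast this
      omega
    have q1 : q < n := by
      have : (q : ℝ) < n := by
        by_contra! hcon
        nlinarith [hu.2, hr.1]
      exact_mod_cast this
    obtain ⟨k, hk⟩ := (R.fold_iff h0 polar _ j).1 hj
    obtain ⟨q, rfl⟩ := Int.eq_ofNat_of_zero_le q0
    refine ⟨r, hr, q, by exact_mod_cast q1, ⟨(j - 1) * (n - m) + k * n - 2 * q * (n - m), ?_⟩, ?_⟩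
    · rw [add] at hk
      have hn := R.cast_n_pos.ne'
      push_cast at hk ⊢
      field_simp at hk ⊢
      linear_combination hk
    · exact_mod_cast hus
  obtain ⟨q, r, hr, hsr⟩ : ∃ (q : ℤ) (r : ℝ), r ∈ Set.Ico 0 ω ∧ s = r + q * ω := by
    refine ⟨⌊s / ω⌋, s - ⌊s / ω⌋ * ω, ⟨?_, ?_⟩, by ring⟩
    · have := Int.floor_le (s / ω)
      rw [le_div_iff₀ hω] at this
      linarith
    · have := Int.lt_floor_add_one (s / ω)
      rw [div_lt_iff₀ hω] at this
      linarith
  have hr0 : r ≠ 0 := fun e => hne (2 * q) (by rw [hsr, e]; push_cast; ring)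
  -- Modulo `ω` the two parameters are `r` and `ω - r`, so exactly one of them falls in `(0, ω/2)`.
  rcases lt_trichotomy r (ω / 2) with h | h | h
  · exact main s hs rfl ⟨j, by rw [← hj, hts]⟩ r ⟨lt_of_le_of_ne hr.1 hr0.symm, h⟩ q hsr
  · exact absurd (by rw [hsr, h]; push_cast; ring) (hne (1 + 2 * q))
  · refine main t ht hts ⟨j, ?_⟩ (ω - r) ⟨by linarith [hr.2], by linarith⟩ (j - q - 1) ?_
    · rw [hts, hj]; ring_nf
    · rw [hj, hsr]; push_cast; ring

end Polar

/-- Two such points of equal height come from parameters congruent up to sign modulo `ω`. Sums of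
elements of `(0, ω/2)` lie strictly between `0` and `ω`, which excludes the reflection; differences
are smaller than `ω/2` in absolute value, which leaves equal `r` and then, off the axis, equal
shifts modulo `n`. -/
theorem encard_crossings {N : ℕ} {r : Fin N → ℝ} (h0 : ∀ s, proj γ s ≠ 0)
    (hr : ∀ i, r i ∈ Set.Ioo 0 (ω / 2)) (inj : Function.Injective r) :
    (Set.range fun a : Fin n × Fin N => γ (r a.2 + (a.1 : ℕ) * ω)).encard = ((n * N : ℕ) : ℕ∞) := by
  have hω := R.omega_pos
  have hinj : Function.Injective fun a : Fin n × Fin N => γ (r a.2 + (a.1 : ℕ) * ω) := by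
    rintro ⟨p, i⟩ ⟨q, k⟩ h
    simp only at h
    obtain ⟨j, hj | hj⟩ := (R.height_eq_iff _ _).1 (congrArg (fun u : E3 => u 0) h)
    · have h1 : r k - r i = ((p + j - q : ℤ) : ℝ) * ω := by push_cast; linarith
      have h2 : (p + j - q : ℤ) = 0 := by
        have a1 : (-1 : ℝ) < ((p + j - q : ℤ) : ℝ) := by
          by_contra! hcon
          nlinarith [(hr i).1, (hr i).2, (hr k).1, (hr k).2]
        have a2 : ((p + j - q : ℤ) : ℝ) < 1 := by
          by_contra! hcon
          nlinarith [(hr i).1, (hr i).2, (hr k).1, (hr k).2]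
        have a1' : (-1 : ℤ) < (p + j - q : ℤ) := by exact_mod_cast a1
        have a2' : (p + j - q : ℤ) < 1 := by exact_mod_cast a2
        omega
      rw [h2, Int.cast_zero, zero_mul, sub_eq_zero] at h1
      have hik : i = k := (inj h1).symm
      subst hik
      have h3 : (n : ℤ) ∣ j := R.dvd_of_proj_eq (h0 _) (by rw [← hj]; simp only [proj, h])
      obtain ⟨l, rfl⟩ := h3
      have hl : l = 0 := by
        have := p.2
        have := q.2
        by_contra hl
        rcases lt_or_gt_of_ne hl with hl | hl
        · have : (n : ℤ) * l ≤ -n := by nlinarith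
          omega
        · have : (n : ℤ) ≤ n * l := by nlinarith
          omega
      rw [hl] at h2
      have : p = q := Fin.ext (by omega)
      rw [this]
    · exfalso
      have h1 : r k + r i = ((j - p - q : ℤ) : ℝ) * ω := by push_cast; linarith
      have a1 : (0 : ℝ) < ((j - p - q : ℤ) : ℝ) := by
        by_contra! hcon
        nlinarith [(hr i).1, (hr i).2, (hr k).1, (hr k).2]
      have a2 : ((j - p - q : ℤ) : ℝ) < 1 := by
        by_contra! hcon
        nlinarith [(hr i).1, (hr i).2, (hr k).1, (hr k).2]
      have a1' : (0 : ℤ) < (j - p - q : ℤ) := by exact_mod_cast a1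
      have a2' : (j - p - q : ℤ) < 1 := by exact_mod_cast a2
      omega
  rw [← Set.image_univ, hinj.encard_image, Set.encard_univ, ENat.card_eq_coe_fintype_card]
  simp

end RotationalCurve

/-! ### Further properties of the angular function and the projection -/

open Filter Topology

namespace Profile

variable {lam ξ e₁ e₂ ω : ℝ} {μ dμ : ℝ → ℝ} (P : Profile lam ξ e₁ e₂ ω μ dμ)
include P

theorem angular_add_int (hne : e₂ + 2 * lam ≠ 0) (s : ℝ) (j : ℤ) :
    angular lam ξ μ (s + j * ω) = angular lam ξ μ s + j * jump lam ξ μ := by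
  have hd : ∀ i : ℤ, ∀ s, angular lam ξ μ (s + i * ω) - angular lam ξ μ s =
      angular lam ξ μ (i * ω) - angular lam ξ μ 0 := by
    intro i s
    have hd : ∀ t, HasDerivAt (fun t => angular lam ξ μ (t + i * ω) - angular lam ξ μ t) 0 t :=
      fun t => by
        have h1 := ((P.deriv_angular hne (t + i * ω)).comp_add_const t (i * ω)).fun_sub
          (P.deriv_angular hne t)
        rw [P.momentum_add_int, P.height_add_int] at h1
        exact h1.congr_deriv (by ring)
    have := is_const_of_deriv_eq_zero (fun t => (hd t).differentiableAt)
      (fun t => (hd t).deriv) s 0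
    simpa using this
  have h1 : ∀ s, angular lam ξ μ (s + ω) = angular lam ξ μ s + jump lam ξ μ := fun s => by
    have := hd 1 s
    rw [Int.cast_one, one_mul] at this
    rw [jump, P.leastPeriod_mu]
    linarith
  have hp : Function.Periodic (fun t => angular lam ξ μ t - t / ω * jump lam ξ μ) ω := fun t => by
    have := P.omega_pos.ne'
    simp only [h1]
    field_simp
    ring
  have := (hp.int_mul j) s
  have hω := P.omega_pos.ne'
  field_simp at this
  have h2 : ω * (angular lam ξ μ (s + j * ω) - (angular lam ξ μ s + j * jump lam ξ μ)) = 0 := by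
    linear_combination this
  linarith [(mul_eq_zero.1 h2).resolve_left hω]

theorem angular_zero : angular lam ξ μ 0 = -(jump lam ξ μ / 2) := by
  have := P.angular_omega_sub 0
  rw [sub_zero] at this
  rw [P.jump_eq]
  linarith

theorem momentum_mid_pos : 0 < momentum lam ξ μ (ω / 2) := by
  have := P.top_pos
  have := P.xi_pos
  simp only [momentum, P.mid]; positivity

theorem momentum_pos_iff (s : ℝ) : 0 < momentum lam ξ μ s ↔ 0 < μ s + 2 * lam := by
  have := P.xi_pos
  rw [momentum, div_pos_iff_of_pos_right (by positivity)]

theorem climb_eq_zero_iff (s : ℝ) : climb ξ μ dμ s = 0 ↔ dμ s = 0 := by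
  have := P.xi_pos.ne'
  have := (P.mu_pos s).ne'
  rw [climb, div_eq_zero_iff, neg_eq_zero, or_iff_left (by positivity)]

theorem planar_eq_zero_iff (h0 : e₂ + 2 * lam = 0) (s : ℝ) :
    planar lam ξ ω μ dμ s = 0 ↔ μ s = e₂ := by
  have h1 : planar lam ξ ω μ dμ s = 0 ↔ 1 - height ξ μ s ^ 2 = 0 := by
    rw [← P.norm_planar_sq s]; simp
  have hu := P.unit s
  have hξ := P.xi_pos
  rw [h1]
  constructor
  · intro h
    have hM : momentum lam ξ μ s ^ 2 = 0 := by
      nlinarith [sq_nonneg (momentum lam ξ μ s), sq_nonneg (climb ξ μ dμ s)]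
    have := (div_eq_zero_iff.1 (pow_eq_zero_iff two_ne_zero |>.1 hM)).resolve_right (by positivity)
    linarith
  · intro h
    have hd := (P.climb_eq_zero_iff s).2 ((P.dmu_eq_zero_iff s).2 (Or.inr h))
    have hm : momentum lam ξ μ s = 0 := by rw [momentum, h, h0, zero_div]
    rw [hd, hm] at hu
    linarith

/-- Near `ω/2` the momentum is positive, so `θ` decreases to `θ(ω/2) = 0`. This provides a crossing
at polar value `0` inside `(0, ω/2)`, without which the count for `e₁ > u_λ` would yield only `m -
1` values. -/
theorem exists_angular_pos (hne : e₂ + 2 * lam ≠ 0) :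
    ∃ r ∈ Set.Ioo 0 (ω / 2), 0 < angular lam ξ μ r := by
  have hω := half_pos P.omega_pos
  have hev : ∀ᶠ s in 𝓝 (ω / 2), 0 < momentum lam ξ μ s :=
    (P.continuous_momentum.tendsto _).eventually (lt_mem_nhds P.momentum_mid_pos)
  obtain ⟨l, hl, hlsub⟩ := exists_Ioc_subset_of_mem_nhds hev ⟨0, hω⟩
  obtain ⟨r, hr1, hr2⟩ := exists_between (max_lt hl hω)
  have hlr : l < r := (le_max_left _ _).trans_lt hr1
  have c : Continuous (angular lam ξ μ) :=
    continuous_iff_continuousAt.2 fun s => (P.deriv_angular hne s).continuousAt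
  have anti : StrictAntiOn (angular lam ξ μ) (Set.Icc r (ω / 2)) := by
    refine strictAntiOn_of_deriv_neg (convex_Icc _ _) c.continuousOn fun s hs => ?_
    rw [interior_Icc] at hs
    rw [(P.deriv_angular hne s).deriv]
    have : 0 < momentum lam ξ μ s := hlsub ⟨hlr.trans hs.1, hs.2.le⟩
    exact div_neg_of_neg_of_pos (by linarith) (P.one_sub_height_sq_pos hne s)
  have := anti (Set.left_mem_Icc.2 hr2.le) (Set.right_mem_Icc.2 hr2.le) hr2
  rw [P.angular_mid] at this
  exact ⟨r, ⟨(le_max_right _ _).trans_lt hr1, hr2⟩, this⟩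

end Profile

/-! ### The standard B-strings -/

namespace IsStandardBString

variable {lam e₁ : ℝ} {γ : ℝ → E3} (hγ : IsStandardBString lam e₁ γ) {m n : ℕ}
  (hmn : HasCharacteristicNumber lam e₁ γ m n)
include hγ

theorem height_eq (s : ℝ) : γ s 0 = height (xi lam e₁) (muInv γ) s := (hγ.coordinates s).1

theorem proj_eq : proj γ = planar lam (xi lam e₁) (leastPeriod (muInv γ)) (muInv γ)
    (deriv (muInv γ)) := funext fun s => (hγ.coordinates s).2.2.2

include hmn

/-- The rotation over a period of the curvature in terms of the characteristic number. -/
theorem turn_eq : 2 * turn lam (xi lam e₁) (leastPeriod (muInv γ)) (muInv γ)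
    (leastPeriod (muInv γ)) = 2 * π * ((n - m) / n) := by
  have P := hγ.profile
  obtain ⟨c1, c2, c3⟩ := exceptional_cases hγ.parameters
  obtain ⟨b1, b2⟩ := P.turn_omega_mem
  set b := turn lam (xi lam e₁) (leastPeriod (muInv γ)) (muInv γ) (leastPeriod (muInv γ))
  have hn : (0 : ℝ) < n := by exact_mod_cast hmn.pos.trans hmn.lt
  have hm : (0 : ℝ) < m := by exact_mod_cast hmn.pos
  have hlt : (m : ℝ) < n := by exact_mod_cast hmn.lt
  have q0 : 0 < (m : ℝ) / n := by positivity
  have q1 : (m : ℝ) / n < 1 := (div_lt_one hn).2 hlt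
  have e : ((n : ℝ) - m) / n = 1 - m / n := by field_simp
  have hπ := Real.pi_pos
  rw [e]
  -- As `0 < 2B(ω) < 2π` and `0 < m/n < 1`, the unknown multiple of `2π` is `-1` below `u_λ` and `0`
  -- above it.
  rcases lt_trichotomy (e₁ : EReal) (exceptional lam) with h | h | h
  · obtain ⟨k, hk⟩ := hmn.jump_of_ne h.ne
    rw [P.jump_of_pos (c1.1 h)] at hk
    have k1 : (k : ℝ) < 0 := by
      by_contra! hcon
      nlinarith
    have k2 : (-2 : ℝ) < k := by
      by_contra! hcon
      nlinarith
    have k1' : k < 0 := by exact_mod_cast k1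
    have k2' : -2 < k := by exact_mod_cast k2
    have : k = -1 := by omega
    rw [this] at hk
    push_cast at hk
    linarith
  · have hk := hmn.jump_of_eq h
    rw [P.jump_of_zero (c2.1 h)] at hk
    linarith
  · obtain ⟨k, hk⟩ := hmn.jump_of_ne h.ne'
    rw [P.jump_of_neg (c3.1 h)] at hk
    have k1 : (k : ℝ) < 1 := by
      by_contra! hcon
      nlinarith
    have k2 : (-1 : ℝ) < k := by
      by_contra! hcon
      nlinarith
    have k1' : k < 1 := by exact_mod_cast k1
    have k2' : -1 < k := by exact_mod_cast k2
    have : k = 0 := by omega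
    rw [this] at hk
    push_cast at hk
    linarith

theorem rotationalCurve : RotationalCurve γ (leastPeriod (muInv γ)) m n := by
  have P := hγ.profile
  have hξ := P.xi_pos
  have hmu : ∀ s t, γ s 0 = γ t 0 ↔ muInv γ s = muInv γ t := by
    intro s t
    have h1 := P.mu_pos s
    have h2 := P.mu_pos t
    rw [hγ.height_eq, hγ.height_eq, height, height, one_div, one_div, inv_inj,
      mul_right_inj' (by positivity)]
  refine
    { omega_pos := P.omega_pos
      pos := hmn.pos
      lt := hmn.lt
      coprime := hmn.coprime
      height_eq_iff := fun s t => (hmu s t).trans (P.mu_eq_iff s t)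
      height_periodic_iff := fun T => ?_
      proj_add_int := fun s j => ?_
      proj_omega_sub := fun s => ?_
      proj_mid := ?_
      height_pos := fun s => ?_
      sphere := fun s => ?_ }
  · rw [← P.period_iff T]
    exact forall_congr' fun s => hmu _ _
  · rw [hγ.proj_eq, P.planar_add_int, hγ.turn_eq hmn]
  · rw [hγ.proj_eq, P.planar_omega_sub]
  · rw [hγ.proj_eq]
    have h2 := P.momentum_mid_pos.ne'
    simp [planar, Profile.turn_mid, P.climb_mid, h2]
  · rw [hγ.height_eq]; exact P.height_pos s
  · rw [hγ.height_eq, hγ.proj_eq, P.norm_planar_sq]; ring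

omit hmn in
theorem bounds (s : ℝ) : 1 / (2 * xi lam e₁ * e₁) ≤ γ s 0 ∧
    γ s 0 ≤ 1 / (2 * xi lam e₁ * eTwo lam e₁) := by
  have P := hγ.profile
  have hξ := P.xi_pos
  have h1 := P.mu_pos s
  have h2 := P.pos
  obtain ⟨h3, h4⟩ := P.mem_Icc s
  rw [hγ.height_eq, height]
  constructor <;> gcongr

omit hγ hmn in
theorem mem_axisOx_iff (s : ℝ) : γ s ∈ axisOx ↔ proj γ s = 0 := by
  simp [axisOx, proj, Complex.ext_iff]

omit hmn in
theorem proj_ne_zero (hne : eTwo lam e₁ + 2 * lam ≠ 0) (s : ℝ) : proj γ s ≠ 0 := by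
  rw [hγ.proj_eq]; exact hγ.profile.planar_ne_zero hne s

omit hmn in
theorem proj_polar (hne : eTwo lam e₁ + 2 * lam ≠ 0) (s : ℝ) : proj γ s =
    -(‖proj γ s‖ : ℂ) *
      Complex.exp ((-angular lam (xi lam e₁) (muInv γ) s : ℝ) * Complex.I) := by
  rw [hγ.proj_eq]; exact hγ.profile.planar_polar hne s

/-- `π - θ` is a continuous argument of the projection, and it changes by `-nΨ` over the `n` periods
of `μ`. -/
theorem hasLinkingNumberOx (hne : eTwo lam e₁ + 2 * lam ≠ 0) {k : ℤ}
    (hk : -(n * jump lam (xi lam e₁) (muInv γ)) = 2 * π * k) : HasLinkingNumberOx γ k := by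
  have P := hγ.profile
  have R := hγ.rotationalCurve hmn
  have c : Continuous (angular lam (xi lam e₁) (muInv γ)) :=
    continuous_iff_continuousAt.2 fun s => (P.deriv_angular hne s).continuousAt
  refine ⟨?_, hγ.proj_ne_zero hne, fun s => π - angular lam (xi lam e₁) (muInv γ) s,
    continuous_const.sub c, fun s => ?_, ?_⟩
  · rw [R.leastPeriod_eq]
    exact (R.proj_period_iff _).2 ⟨1, by simp⟩
  · conv_lhs => rw [hγ.proj_polar hne s]
    simp only [sub_eq_add_neg]
    rw [Complex.ofReal_add, add_mul, Complex.exp_add, Complex.exp_pi_mul_I]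
    ring
  · have := P.angular_add_int hne 0 n
    rw [R.leastPeriod_eq]
    push_cast at this
    rw [zero_add] at this
    simp only [this]
    linarith

theorem linking_of_lt (hpos : 0 < eTwo lam e₁ + 2 * lam) :
    HasLinkingNumberOx γ ((n : ℤ) - m) := by
  refine hγ.hasLinkingNumberOx hmn hpos.ne' ?_
  have hn : (n : ℝ) ≠ 0 := by exact_mod_cast (hmn.pos.trans hmn.lt).ne'
  rw [hγ.profile.jump_of_pos hpos, hγ.turn_eq hmn]
  push_cast
  field_simp

theorem linking_of_gt (hneg : eTwo lam e₁ + 2 * lam < 0) : HasLinkingNumberOx γ (-(m : ℤ)) := by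
  refine hγ.hasLinkingNumberOx hmn hneg.ne ?_
  have hn : (n : ℝ) ≠ 0 := by exact_mod_cast (hmn.pos.trans hmn.lt).ne'
  rw [hγ.profile.jump_of_neg hneg, hγ.turn_eq hmn]
  push_cast
  field_simp
  ring

/-- At the two passages `v` takes opposite nonzero values, while `m > 0` is the same. In a linear
relation between the velocities the `x`-coordinate makes the coefficients equal, and the moment
about the axis then makes their sum vanish. -/
theorem selfIntersections_eq (hpos : 0 < eTwo lam e₁ + 2 * lam) :
    selfIntersections γ = ordinaryDoublePoints γ := by
  have P := hγ.profile
  have R := hγ.rotationalCurve hmn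
  have h0 := hγ.proj_ne_zero hpos.ne'
  refine Set.Subset.antisymm (fun p hp => ?_) ?_
  · obtain ⟨s, t, hs, ht, hst, rfl, hts⟩ := (R.mem_selfIntersections_iff p).1 hp
    refine ⟨s, t, hst, R.passages_eq (h0 s) hs ht hst hts.symm, ?_⟩
    obtain ⟨j, hj⟩ := R.sum_of_eq (h0 s) hs ht hst hts.symm
    obtain ⟨-, ms, vs, -⟩ := hγ.coordinates s
    obtain ⟨-, mt, vt, -⟩ := hγ.coordinates t
    have e1 : muInv γ t = muInv γ s := ((P.mu_eq_iff s t).2 ⟨j, Or.inr hj⟩).symm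
    have e2 : climb (xi lam e₁) (muInv γ) (deriv (muInv γ)) t =
        -climb (xi lam e₁) (muInv γ) (deriv (muInv γ)) s := by
      rw [← P.climb_omega_sub, ← P.climb_add_int (leastPeriod (muInv γ) - s) (j - 1), hj]
      push_cast
      ring_nf
    have e3 : momentum lam (xi lam e₁) (muInv γ) t = momentum lam (xi lam e₁) (muInv γ) s := by
      simp only [momentum, e1]
    have hV : climb (xi lam e₁) (muInv γ) (deriv (muInv γ)) s ≠ 0 := by
      intro hV
      obtain ⟨k, hk⟩ := P.exists_of_dmu_eq_zero ((P.climb_eq_zero_iff s).1 hV)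
      have h1 : t = s + ((j - k : ℤ) : ℝ) * leastPeriod (muInv γ) := by
        rw [hj]; push_cast; linarith
      have h2 := R.dvd_of_proj_eq (h0 s) (j := j - k) (by rw [← h1]; simp only [proj, hts])
      exact hst (R.eq_of_dvd hs ht h2 h1).symm
    have hM : 0 < momentum lam (xi lam e₁) (muInv γ) s :=
      (P.momentum_pos_iff s).2 (by linarith [(P.mem_Icc s).1])
    rw [LinearIndependent.pair_iff]
    intro a b hab
    have c0 := congrArg (fun u : E3 => u 0) hab
    have c1 := congrArg (fun u : E3 => u 1) hab
    have c2 := congrArg (fun u : E3 => u 2) hab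
    simp only [PiLp.add_apply, PiLp.smul_apply, smul_eq_mul, PiLp.zero_apply] at c0 c1 c2
    rw [vs, vt, e2] at c0
    have hab' : a = b := by
      have : (a - b) * climb (xi lam e₁) (muInv γ) (deriv (muInv γ)) s = 0 := by
        linear_combination c0
      linarith [(mul_eq_zero.1 this).resolve_right hV]
    rw [e3, hts] at mt
    have : (a + b) * momentum lam (xi lam e₁) (muInv γ) s = 0 := by
      linear_combination γ s 1 * c2 - γ s 2 * c1 - a * ms - b * mt
    have := (mul_eq_zero.1 this).resolve_right hM.ne'
    constructor <;> linarith
  · rintro p ⟨s, t, hst, hp, -⟩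
    show 2 ≤ (passages γ p).encard
    rw [hp, Set.encard_pair hst]

/-- Here `-θ` is strictly increasing and runs from `-π(n - m)/n` at `0` to `0` at `ω/2`. It takes
each interior multiple of `π/n` exactly once, which gives `n - m - 1` crossings up to the `n`
shifts. -/
theorem encard_selfIntersections (hpos : 0 < eTwo lam e₁ + 2 * lam) :
    (selfIntersections γ).encard = ((n * (n - m - 1) : ℕ) : ℕ∞) := by
  have P := hγ.profile
  have R := hγ.rotationalCurve hmn
  have h0 := hγ.proj_ne_zero hpos.ne'
  have hpolar := hγ.proj_polar hpos.ne'
  set ω := leastPeriod (muInv γ) with hω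
  set φ : ℝ → ℝ := fun s => -angular lam (xi lam e₁) (muInv γ) s with hφ
  have hπ := Real.pi_pos
  have hn := R.cast_n_pos
  have hjump : jump lam (xi lam e₁) (muInv γ) = -(2 * π * ((n - m) / n)) := by
    rw [P.jump_of_pos hpos, hγ.turn_eq hmn]
  have dφ : ∀ s, HasDerivAt φ (-(-momentum lam (xi lam e₁) (muInv γ) s /
      (1 - height (xi lam e₁) (muInv γ) s ^ 2))) s := fun s => (P.deriv_angular hpos.ne' s).neg
  have mono : StrictMono φ := by
    refine strictMono_of_deriv_pos fun s => ?_
    rw [(dφ s).deriv, neg_div, neg_neg]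
    exact div_pos ((P.momentum_pos_iff s).2 (by linarith [(P.mem_Icc s).1]))
      (P.one_sub_height_sq_pos hpos.ne' s)
  have cφ : Continuous φ := continuous_iff_continuousAt.2 fun s => (dφ s).continuousAt
  have φ0 : φ 0 = -(π * ((n - m) / n)) := by
    simp only [hφ]; rw [P.angular_zero, hjump]; ring
  have φ1 : φ (ω / 2) = 0 := by simp only [hφ]; rw [P.angular_mid, neg_zero]
  have hω0 : 0 ≤ ω / 2 := (half_pos P.omega_pos).le
  -- The index `i`, counted from `0`, stands for the multiple `-(i + 1)`; both endpoint values are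
  -- left out.
  have hval : ∀ i : Fin (n - m - 1), π * ((-((i : ℕ) + 1) : ℤ) : ℝ) / n ∈ Set.Ioo (φ 0) (φ (ω / 2)) := by
    intro i
    have h1 : ((i : ℕ) : ℝ) + 1 < n - m := by
      have := i.2
      have h2 : (i : ℕ) + 1 + m < n := by omega
      have h3 : ((i : ℕ) : ℝ) + 1 + m < n := by exact_mod_cast h2
      linarith
    have h2 : (0 : ℝ) ≤ (i : ℕ) := Nat.cast_nonneg _
    rw [φ0, φ1]
    push_cast
    constructor
    · rw [lt_div_iff₀ hn]
      have : -(π * ((n - m) / n)) * n = -(π * (n - m)) := by field_simp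
      rw [this]
      nlinarith
    · exact div_neg_of_neg_of_pos (by nlinarith) hn
  have hex := fun i => intermediate_value_Ioo hω0 cφ.continuousOn (hval i)
  choose r hr hrv using hex
  have inj : Function.Injective r := by
    intro i k hik
    have h1 := hrv i
    rw [hik, hrv k, div_left_inj' hn.ne', mul_right_inj' hπ.ne'] at h1
    have h2 : (-((k : ℕ) + 1) : ℤ) = -((i : ℕ) + 1) := by exact_mod_cast h1
    exact Fin.ext (by omega)
  rw [← R.encard_crossings h0 hr inj]
  congr 1
  ext p
  constructor
  · intro hp
    obtain ⟨x, hx, q, hq, ⟨i, hi⟩, rfl⟩ := R.exists_of_mem_selfIntersections h0 hpolar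
      (fun s j => by
        rw [P.angular_add_int hpos.ne', hjump]
        ring) hp
    have l1 := mono hx.1
    have l2 := mono hx.2
    rw [φ0] at l1
    rw [φ1] at l2
    have hi' : φ x = π * i / n := hi
    rw [hi'] at l1 l2
    have i1 : (i : ℝ) < 0 := by
      by_contra! hcon
      have : 0 ≤ π * i / n := by positivity
      linarith
    have i2 : -((n : ℝ) - m) < i := by
      rw [lt_div_iff₀ hn] at l1
      have : -(π * ((n - m) / n)) * n = π * (-(n - m)) := by field_simp
      rw [this] at l1
      exact lt_of_mul_lt_mul_left l1 hπ.le
    have i1' : i < 0 := by exact_mod_cast i1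
    have i2' : -((n : ℤ) - m) < i := by exact_mod_cast i2
    have hm := R.lt
    refine ⟨(⟨q, hq⟩, ⟨(-i - 1).toNat, by omega⟩), ?_⟩
    simp only
    congr 2
    apply mono.injective
    rw [hi', hrv]
    congr 3
    simp only
    omega
  · rintro ⟨⟨q, i⟩, rfl⟩
    have := R.mem_selfIntersections h0 hpolar (hr i) (hrv i) (q : ℕ)
    exact_mod_cast this

/-- Now `m` changes sign and `-θ` is not monotone, so the intermediate value theorem gives only a
lower bound. From `πm/n` at `0` to a negative value, `-θ` meets `πi/n` for every `0 ≤ i < m`. -/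
theorem le_encard_selfIntersections (hneg : eTwo lam e₁ + 2 * lam < 0) :
    ((n * m : ℕ) : ℕ∞) ≤ (selfIntersections γ).encard := by
  have P := hγ.profile
  have R := hγ.rotationalCurve hmn
  have h0 := hγ.proj_ne_zero hneg.ne
  have hpolar := hγ.proj_polar hneg.ne
  set ω := leastPeriod (muInv γ) with hω
  set φ : ℝ → ℝ := fun s => -angular lam (xi lam e₁) (muInv γ) s with hφ
  have hπ := Real.pi_pos
  have hn := R.cast_n_pos
  have cφ : Continuous φ := continuous_iff_continuousAt.2 fun s =>
    (P.deriv_angular hneg.ne s).neg.continuousAt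
  have φ0 : φ 0 = π * (m / n) := by
    simp only [hφ]
    rw [P.angular_zero, P.jump_of_neg hneg, hγ.turn_eq hmn]
    field_simp
    ring
  obtain ⟨x, hx, hxpos⟩ := P.exists_angular_pos hneg.ne
  have φx : φ x < 0 := by simp only [hφ]; linarith
  have hval : ∀ i : Fin m, π * (((i : ℕ) : ℤ) : ℝ) / n ∈ Set.Ioo (φ x) (φ 0) := by
    intro i
    have h1 : ((i : ℕ) : ℝ) < m := by exact_mod_cast i.2
    have h2 : (0 : ℝ) ≤ (i : ℕ) := Nat.cast_nonneg _
    rw [φ0]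
    push_cast
    constructor
    · have : 0 ≤ π * (i : ℕ) / n := by positivity
      linarith
    · rw [mul_div_assoc]
      gcongr
  have hex := fun i => intermediate_value_Ioo' hx.1.le cφ.continuousOn (hval i)
  choose r hr hrv using hex
  have hr' : ∀ i, r i ∈ Set.Ioo 0 (ω / 2) := fun i => ⟨(hr i).1, (hr i).2.trans hx.2⟩
  have inj : Function.Injective r := by
    intro i k hik
    have h1 := hrv i
    rw [hik, hrv k, div_left_inj' hn.ne', mul_right_inj' hπ.ne'] at h1
    have h2 : ((k : ℕ) : ℤ) = (i : ℕ) := by exact_mod_cast h1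
    exact Fin.ext (by omega)
  rw [← R.encard_crossings h0 hr' inj]
  refine Set.encard_le_encard ?_
  rintro _ ⟨⟨q, i⟩, rfl⟩
  have := R.mem_selfIntersections h0 hpolar (hr' i) (hrv i) (q : ℕ)
  exact_mod_cast this

/-- The axis is met exactly where `μ` attains its minimum `e₂ = μ 0`, that is, at the multiples of
`ω`. -/
theorem encard_axis (hzero : eTwo lam e₁ + 2 * lam = 0) :
    {s : ℝ | s ∈ Set.Ico 0 (leastPeriod γ) ∧ γ s ∈ axisOx}.encard = (n : ℕ∞) := by
  have P := hγ.profile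
  have R := hγ.rotationalCurve hmn
  set ω := leastPeriod (muInv γ) with hω
  have hω0 := P.omega_pos
  have hinj : Function.Injective fun i : Fin n => ((i : ℕ) : ℝ) * ω := by
    intro i k h
    have := mul_right_cancel₀ hω0.ne' h
    exact Fin.ext (by exact_mod_cast this)
  have hset : {s : ℝ | s ∈ Set.Ico 0 (leastPeriod γ) ∧ γ s ∈ axisOx} =
      Set.range fun i : Fin n => ((i : ℕ) : ℝ) * ω := by
    ext s
    rw [Set.mem_ofPred_eq, R.leastPeriod_eq, mem_axisOx_iff, hγ.proj_eq,
      P.planar_eq_zero_iff hzero, ← P.mu_zero, eq_comm, P.mu_eq_iff]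
    constructor
    · rintro ⟨hs, j, hj⟩
      have hj' : s = j * ω := by
        rcases hj with h | h <;> simpa using h
      subst hj'
      have j0 : (-1 : ℝ) < j := by
        by_contra! hcon
        nlinarith [hs.1]
      have j0' : (-1 : ℤ) < j := by exact_mod_cast j0
      have j1 : (j : ℝ) < n := lt_of_mul_lt_mul_right hs.2 hω0.le
      have j1' : j < n := by exact_mod_cast j1
      obtain ⟨k, rfl⟩ := Int.eq_ofNat_of_zero_le (show 0 ≤ j by omega)
      exact ⟨⟨k, by exact_mod_cast j1'⟩, by simp⟩
    · rintro ⟨i, rfl⟩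
      have h1 : ((i : ℕ) : ℝ) < n := by exact_mod_cast i.2
      exact ⟨⟨by positivity, by simp only; gcongr⟩, (i : ℕ), Or.inl (by simp)⟩
  rw [hset, ← Set.image_univ, hinj.encard_image, Set.encard_univ, ENat.card_eq_coe_fintype_card]
  simp

omit hmn in
theorem angular_momentum_pos (hzero : eTwo lam e₁ + 2 * lam = 0) {s : ℝ} (hs : γ s ∉ axisOx) :
    0 < γ s 1 * deriv γ s 2 - γ s 2 * deriv γ s 1 := by
  have P := hγ.profile
  rw [mem_axisOx_iff, hγ.proj_eq, P.planar_eq_zero_iff hzero] at hs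
  rw [(hγ.coordinates s).2.1, P.momentum_pos_iff]
  have := lt_of_le_of_ne (P.mem_Icc s).1 (Ne.symm hs)
  linarith

/-- The velocity is `-i z e^{iB}` with `Re z > 0`, so the principal argument of `z` is continuous
and takes equal values at `0` and `nω`. The total turn is therefore `2nB(ω)`. The argument does not
depend on the position of `e₁` relative to `u_λ`. -/
theorem hasTurningNumber : HasTurningNumber (proj γ) ((n : ℤ) - m) := by
  have P := hγ.profile
  have R := hγ.rotationalCurve hmn
  have hper := (R.proj_period_iff (n * leastPeriod (muInv γ))).2 ⟨1, by simp⟩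
  rw [HasTurningNumber, R.leastPeriod_proj_eq]
  have ht := hγ.turn_eq hmn
  rw [hγ.proj_eq] at hper ⊢
  set ω := leastPeriod (muInv γ)
  set μ := muInv γ
  set ξ := xi lam e₁
  set h := height ξ μ
  set v := climb ξ μ (deriv μ)
  set p := momentum lam ξ μ
  set B := turn lam ξ ω μ
  let z : ℝ → ℂ := fun s => ((h s + p s ^ 2 / (1 + h s) : ℝ) : ℂ) -
    ((p s * v s / (1 + h s) : ℝ) : ℂ) * Complex.I
  have hd : ∀ s, HasDerivAt (planar lam ξ ω μ (deriv μ))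
      (z s * (-Complex.I) * Complex.exp (B s * Complex.I)) s := P.deriv_planar
  have hz : ∀ s, 0 < (z s).re := fun s => by
    have h1 : 0 < h s := P.height_pos s
    have : (z s).re = h s + p s ^ 2 / (1 + h s) := by
      rw [Complex.sub_re, Complex.ofReal_re, Complex.re_ofReal_mul, Complex.I_re, mul_zero, sub_zero]
    rw [this]
    positivity
  have hz0 : ∀ s, z s ≠ 0 := fun s e => by have := hz s; rw [e] at this; simp at this
  have cz : Continuous z := by
    have c1 : Continuous h := P.continuous_height
    have c2 : Continuous v := P.continuous_climb
    have c3 : Continuous p := P.continuous_momentum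
    have h1 : ∀ s, 1 + h s ≠ 0 := fun s => (P.one_add_height_pos s).ne'
    refine Continuous.sub (Complex.continuous_ofReal.comp ?_)
      ((Complex.continuous_ofReal.comp ?_).mul continuous_const) <;>
    fun_prop (disch := assumption)
  have dd : deriv (planar lam ξ ω μ (deriv μ)) = fun s => z s * (-Complex.I) *
    Complex.exp (B s * Complex.I) := funext fun s => (hd s).deriv
  refine ⟨hper, fun s => (hd s).differentiableAt, fun s => ?_, fun s => ?_,
    fun s => B s - π / 2 + (z s).arg, ?_, fun s => ?_, ?_⟩
  · have h1 := (hd (s + n * ω)).comp_add_const s (n * ω)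
    rw [show (fun t => planar lam ξ ω μ (deriv μ) (t + n * ω)) = planar lam ξ ω μ (deriv μ) from
      funext hper] at h1
    rw [(hd (s + n * ω)).deriv, h1.deriv]
  · rw [dd]
    exact mul_ne_zero (mul_ne_zero (hz0 s) (neg_ne_zero.2 Complex.I_ne_zero)) (Complex.exp_ne_zero _)
  · refine (P.continuous_turn.sub continuous_const).add (continuous_iff_continuousAt.2 fun s => ?_)
    exact (Complex.continuousAt_arg (Or.inl (hz s))).comp cz.continuousAt
  · have e1 : Complex.exp (-(π / 2 : ℝ) * Complex.I) = -Complex.I := by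
      push_cast
      rw [neg_mul, Complex.exp_neg, Complex.exp_pi_div_two_mul_I, Complex.inv_I]
    rw [dd]
    simp only [norm_mul, norm_neg, Complex.norm_I, mul_one, Complex.norm_exp_ofReal_mul_I]
    have e2 : (((B s - π / 2 + (z s).arg : ℝ)) : ℂ) * Complex.I = B s * Complex.I +
        -(π / 2 : ℝ) * Complex.I + (z s).arg * Complex.I := by push_cast; ring
    rw [e2, Complex.exp_add, Complex.exp_add, e1]
    conv_lhs => rw [← Complex.norm_mul_exp_arg_mul_I (z s)]
    ring
  · have h1 := P.turn_add_int 0 n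
    have h2 := P.height_add_int 0 n
    have h3 := P.momentum_add_int 0 n
    have h4 := P.climb_add_int 0 n
    rw [zero_add, Int.cast_natCast] at h1 h2 h3 h4
    have h5 : z (n * ω) = z 0 := by simp only [z, h, p, v, h2, h3, h4]
    have hn := R.cast_n_pos.ne'
    change B (n * ω) = B 0 + n * (2 * B ω) at h1
    simp only [h5, h1, ht]
    push_cast
    field_simp
    ring

end IsStandardBString
end BCurves

/-! ### The main theorem -/

theorem mainTheorem3 (lam e₁ : ℝ) (γ : ℝ → BCurves.E3)
    (hγ : BCurves.IsStandardBString lam e₁ γ)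
    (m n : ℕ) (hmn : BCurves.HasCharacteristicNumber lam e₁ γ m n) :
    -- the symmetry group and the bounding planes
    (∀ k : ℤ, BCurves.rotOx (k * (2 * Real.pi / n)) '' Set.range γ = Set.range γ) ∧
    (∀ s, 1 / (2 * BCurves.xi lam e₁ * e₁) ≤ γ s 0 ∧
      γ s 0 ≤ 1 / (2 * BCurves.xi lam e₁ * BCurves.eTwo lam e₁)) ∧
    -- the non-exceptional cases
    ((e₁ : EReal) ≠ BCurves.exceptional lam → ∀ s, γ s ∉ BCurves.axisOx) ∧
    ((e₁ : EReal) < BCurves.exceptional lam →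
      BCurves.HasLinkingNumberOx γ ((n : ℤ) - m) ∧
      (BCurves.ordinaryDoublePoints γ).encard = ((n * (n - m - 1) : ℕ) : ℕ∞) ∧
      BCurves.selfIntersections γ = BCurves.ordinaryDoublePoints γ) ∧
    (BCurves.exceptional lam < (e₁ : EReal) →
      BCurves.HasLinkingNumberOx γ (-(m : ℤ)) ∧
      ((n * m : ℕ) : ℕ∞) ≤ (BCurves.selfIntersections γ).encard) ∧
    -- the exceptional case
    ((e₁ : EReal) = BCurves.exceptional lam →
      {s : ℝ | s ∈ Set.Ico 0 (BCurves.leastPeriod γ) ∧ γ s ∈ BCurves.axisOx}.encard = (n : ℕ∞) ∧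
      (∀ s, γ s ∉ BCurves.axisOx →
        0 < γ s 1 * deriv γ s 2 - γ s 2 * deriv γ s 1) ∧
      BCurves.HasTurningNumber (BCurves.proj γ) ((n : ℤ) - m)) := by
  have hR := hγ.rotationalCurve hmn
  obtain ⟨c1, c2, c3⟩ := BCurves.exceptional_cases hγ.parameters
  refine ⟨hR.image_rotOx, hγ.bounds, fun h s => ?_, fun h => ?_, fun h => ?_, fun h => ?_⟩
  · rw [BCurves.IsStandardBString.mem_axisOx_iff]
    exact hγ.proj_ne_zero (fun e => h (c2.2 e)) s
  · have hpos := c1.1 h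
    have heq := hγ.selfIntersections_eq hmn hpos
    exact ⟨hγ.linking_of_lt hmn hpos, heq ▸ hγ.encard_selfIntersections hmn hpos, heq⟩
  · exact ⟨hγ.linking_of_gt hmn (c3.1 h), hγ.le_encard_selfIntersections hmn (c3.1 h)⟩
  · exact ⟨hγ.encard_axis hmn (c2.1 h), fun s hs => hγ.angular_momentum_pos (c2.1 h) hs,
      hγ.hasTurningNumber hmn⟩
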